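/- **Lemma 5.1.** Let $n\in\mathbb N$, $n\ge 1$, $s\in(0,1)$, $p>1$, $\Lambda\ge1$, and let $k:\mathbb R^n\times\mathbb R^n\to[0,\infty]$ be measurable and symmetric with $\Lambda^{-1}|x-y|^{-n-sp}\le k(x,y)\le\Lambda|x-y|^{-n-sp}$ for $x\ne y$. Put $$\mathcal E^k(u,v)=\int_{\mathbb R^n}\int_{\mathbb R^n}|u(x)-u(y)|^{p-2}(u(x)-u(y))(v(x)-v(y))\,k(x,y)\,dy\,dx$$ whenever this integral converges absolutely. Let $W^{s,p}$ and $W^{s,p}_{\mathrm{loc}}$ be the usual fractional Sobolev spaces (Gagliardo norm), for open $U\subset\mathbb R^n$ let $W^{s,p}_0(U)$ be the closure of $C_c^\infty(U)$ in $W^{s,p}(\mathbb R^n)$, and let $L^{p-1}_{sp}(\mathbb R^n)$ be the space of $u\in L^{p-1}_{\mathrm{loc}}(\mathbb R^n)$ with $\int_{\mathbb R^n}|u(y)|^{p-1}(1+|y|)^{-n-sp}\,dy<\infty$. A function $u:\mathbb R^n\to\mathbb R$ is *$\mathcal L$-harmonic in $U$* if $u\in W^{s,p}_{\mathrm{loc}}(U)\cap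 L^{p-1}_{sp}(\mathbb R^n)$, $u$ is continuous in $U$, and $\mathcal E^k(u,\varphi)=0$ for all $\varphi\in C_c^\infty(U)$. Let $\Omega\subset\mathbb R^n$ be a bounded open set and $K\subset\Omega$ a compact set. Let $u=\mathfrak R(K,\Omega)$ be the $\mathcal L$-potential of $K$ in $\Omega$, that is, the $\mathcal L$-harmonic function $u$ in $\Omega\setminus K$ with $u-\psi\in W^{s,p}_0(\Omega\setminus K)$, where $\psi\in C_c^\infty(\Omega)$, $0\le\psi\le1$ and $\psi=1$ on $K$ (it does not depend on the choice of $\psi$, up to null sets). Let $\mu_u$ be its $\mathcal L$-distribution, that is, the nonnegative Radon measure in $\Omega$ with $\int_\Omega\varphi\,d\mu_u=\mathcal E^k(u,\varphi)$ for all $\varphi\in C_c^\infty(\Omega)$. Then $$\mu_u(E)\le\Lambda\,\mathrm{cap}_{s,p}(K\cap E,\Omega)\qquad\text{for every compact set }E\subset\Omega,$$ where, for compact $F\subset\Omega$, $$\mathrm{cap}_{s,p}(F,\Omega)=\inf\Big\{\int_{\mathbb R^n}\int_{\mathbb R^n}\frac{|v(x)-v(y)|^p}{|x-y|^{n+sp}}\,dy\,dx:\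 v\in C_c^\infty(\Omega),\ v\ge1\text{ on }F\Big\}.$$ -/

import Mathlib

open MeasureTheory Filter Topology Set
open scoped ENNReal ContDiff

noncomputable section

namespace Nonlocal

/-- The Euclidean space `ℝⁿ`, with its Euclidean norm and Lebesgue measure. -/
abbrev Rn (n : ℕ) : Type := EuclideanSpace ℝ (Fin n)

variable {n : ℕ}

/-- `C_c^∞(U)`: smooth functions on `ℝⁿ` whose support is a compact subset of `U`. -/
structure IsTest (U : Set (Rn n)) (φ : Rn n → ℝ) : Prop where
  smooth : ContDiff ℝ ∞ φ
  compact : HasCompactSupport φ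
  support_subset : tsupport φ ⊆ U

/-- The `p`-th power `[u]_{W^{s,p}(U)}^p = ∫_U ∫_U |u(x) - u(y)|^p / |x - y|^{n+sp} dy dx`
of the Gagliardo seminorm. -/
def gagliardo (s p : ℝ) (U : Set (Rn n)) (u : Rn n → ℝ) : ℝ≥0∞ :=
  ∫⁻ x in U, ∫⁻ y in U, ‖u x - u y‖ₑ ^ p / ‖x - y‖ₑ ^ ((n : ℝ) + s * p)

/-- The norm of `W^{s,p}(U)`, with value `∞` where it is not finite. -/
def sobolevNorm (s p : ℝ) (U : Set (Rn n)) (u : Rn n → ℝ) : ℝ≥0∞ :=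
  ((∫⁻ x in U, ‖u x‖ₑ ^ p) + gagliardo s p U u) ^ (1 / p)

/-- `u ∈ W^{s,p}(U)`. -/
def MemW (s p : ℝ) (U : Set (Rn n)) (u : Rn n → ℝ) : Prop :=
  AEStronglyMeasurable u (volume.restrict U) ∧ sobolevNorm s p U u < ⊤

/-- `u ∈ W^{s,p}_loc(U)`: `u ∈ W^{s,p}(U')` for every open `U'` whose closure is a compact subset
of `U`. -/
def MemWloc (s p : ℝ) (U : Set (Rn n)) (u : Rn n → ℝ) : Prop :=
  ∀ U' : Set (Rn n), IsOpen U' → IsCompact (closure U') → closure U' ⊆ U → MemW s p U' u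

/-- `u ∈ W^{s,p}_0(U)`: the closure of `C_c^∞(U)` in `W^{s,p}(ℝⁿ)`. -/
def MemW₀ (s p : ℝ) (U : Set (Rn n)) (u : Rn n → ℝ) : Prop :=
  MemW s p univ u ∧
    ∃ φ : ℕ → Rn n → ℝ, (∀ j, IsTest U (φ j)) ∧
      Tendsto (fun j => sobolevNorm s p univ (fun x => u x - φ j x)) atTop (𝓝 0)

/-- The tail space `L^{p-1}_{sp}(ℝⁿ)`. -/
def MemTail (s p : ℝ) (u : Rn n → ℝ) : Prop :=
  AEStronglyMeasurable u volume ∧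
    (∀ A : Set (Rn n), IsCompact A → ∫⁻ y in A, ‖u y‖ₑ ^ (p - 1) < ⊤) ∧
    ∫⁻ y, ‖u y‖ₑ ^ (p - 1) / ENNReal.ofReal ((1 + ‖y‖) ^ ((n : ℝ) + s * p)) < ⊤

/-- A measurable symmetric kernel `k : ℝⁿ × ℝⁿ → [0, ∞]` with
`Λ⁻¹ |x - y|^{-n-sp} ≤ k(x, y) ≤ Λ |x - y|^{-n-sp}` off the diagonal. -/
structure IsEllipticKernel (s p Λ : ℝ) (k : Rn n → Rn n → ℝ≥0∞) : Prop where
  measurable : Measurable (Function.uncurry k)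
  symm : ∀ x y, k x y = k y x
  lower : ∀ x y, x ≠ y → ENNReal.ofReal (Λ⁻¹ / ‖x - y‖ ^ ((n : ℝ) + s * p)) ≤ k x y
  upper : ∀ x y, x ≠ y → k x y ≤ ENNReal.ofReal (Λ / ‖x - y‖ ^ ((n : ℝ) + s * p))

/-- The integrand `|u(x)-u(y)|^{p-2} (u(x)-u(y)) (v(x)-v(y)) k(x,y)` of `𝓔^k(u, v)`. It vanishes
on the diagonal, and off the diagonal the kernels considered here are finite. -/
def formIntegrand (p : ℝ) (k : Rn n → Rn n → ℝ≥0∞) (u v : Rn n → ℝ) (z : Rn n × Rn n) : ℝ :=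
  |u z.1 - u z.2| ^ (p - 2) * (u z.1 - u z.2) * (v z.1 - v z.2) * (k z.1 z.2).toReal

/-- `𝓔^k(u, v)` is well defined and finite, as an absolutely convergent double integral. -/
def FormFinite (p : ℝ) (k : Rn n → Rn n → ℝ≥0∞) (u v : Rn n → ℝ) : Prop :=
  Integrable (formIntegrand p k u v) (volume.prod volume)

/-- The form `𝓔^k(u, v)`; meaningful where `FormFinite p k u v` holds. -/
def form (p : ℝ) (k : Rn n → Rn n → ℝ≥0∞) (u v : Rn n → ℝ) : ℝ :=
  ∫ z, formIntegrand p k u v z ∂(volume.prod volume)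

/-- `u` is a weak supersolution of `𝓛u = 0` in `U`. -/
structure IsWeakSupersolution (s p : ℝ) (k : Rn n → Rn n → ℝ≥0∞) (U : Set (Rn n))
    (u : Rn n → ℝ) : Prop where
  measurable : AEStronglyMeasurable u volume
  memWloc : MemWloc s p U u
  memTail : MemTail s p (fun x => max (-u x) 0)
  form_nonneg : ∀ φ : Rn n → ℝ, IsTest U φ → (∀ x, 0 ≤ φ x) →
    FormFinite p k u φ ∧ 0 ≤ form p k u φ

/-- `u` is a weak subsolution of `𝓛u = 0` in `U`. -/
def IsWeakSubsolution (s p : ℝ) (k : Rn n → Rn n → ℝ≥0∞) (U : Set (Rn n))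
    (u : Rn n → ℝ) : Prop :=
  IsWeakSupersolution s p k U (fun x => -u x)

/-- `u` is a weak solution of `𝓛u = 0` in `U`. -/
def IsWeakSolution (s p : ℝ) (k : Rn n → Rn n → ℝ≥0∞) (U : Set (Rn n))
    (u : Rn n → ℝ) : Prop :=
  IsWeakSupersolution s p k U u ∧ IsWeakSubsolution s p k U u

/-- `u` is `𝓛`-harmonic in `U`: a weak solution of `𝓛u = 0` that is continuous in `U`. -/
def IsHarmonic (s p : ℝ) (k : Rn n → Rn n → ℝ≥0∞) (U : Set (Rn n)) (u : Rn n → ℝ) : Prop :=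
  IsWeakSolution s p k U u ∧ ContinuousOn u U

/-- `u = ℜ(K, Ω)` is the `𝓛`-potential of `K` in `Ω`: it is `𝓛`-harmonic in `Ω \ K` and
`u - ψ ∈ W^{s,p}_0(Ω \ K)` for a cut-off function `ψ ∈ C_c^∞(Ω)` with values in `[0, 1]` and
`ψ = 1` on `K`. -/
def IsPotential (s p : ℝ) (k : Rn n → Rn n → ℝ≥0∞) (K Ω : Set (Rn n)) (u : Rn n → ℝ) : Prop :=
  IsHarmonic s p k (Ω \ K) u ∧
    ∃ ψ : Rn n → ℝ, IsTest Ω ψ ∧ (∀ x, ψ x ∈ Icc (0 : ℝ) 1) ∧ (∀ x ∈ K, ψ x = 1) ∧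
      MemW₀ s p (Ω \ K) (fun x => u x - ψ x)

/-- `μ` is a nonnegative Radon measure in `Ω` (seen as a Borel measure on `ℝⁿ` carried by `Ω` and
finite on the compact subsets of `Ω`) with `𝓛u = μ` in `Ω` in the sense of distributions:
`∫_Ω φ dμ = 𝓔^k(u, φ)` for all `φ ∈ C_c^∞(Ω)`. -/
structure IsDistribution (p : ℝ) (k : Rn n → Rn n → ℝ≥0∞) (Ω : Set (Rn n)) (u : Rn n → ℝ)
    (μ : Measure (Rn n)) : Prop where
  carried : μ Ωᶜ = 0
  finite_on_compacts : ∀ A : Set (Rn n), IsCompact A → A ⊆ Ω → μ A < ⊤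
  integral_eq : ∀ φ : Rn n → ℝ, IsTest Ω φ →
    FormFinite p k u φ ∧ ∫ x in Ω, φ x ∂μ = form p k u φ

/-- The `(s, p)`-capacity of `K` with respect to `Ω`: the infimum of `𝓔^{s,p}(v)` over
`v ∈ C_c^∞(Ω)` with `v ≥ 1` on `K`. -/
def capacity (s p : ℝ) (K Ω : Set (Rn n)) : ℝ≥0∞ :=
  ⨅ v ∈ {v : Rn n → ℝ | IsTest Ω v ∧ ∀ x ∈ K, 1 ≤ v x}, gagliardo s p univ v

end Nonlocal

end

open MeasureTheory Filter Topology Set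
open scoped ENNReal ContDiff NNReal

noncomputable section

namespace Nonlocal

variable {n : ℕ}

/-! Since `u` solves the equation off `K`, the measure `μ` does not charge `Ω \ K`, so `μ E ≤ μ F`
with `F = K ∩ E`. For an admissible `v` (`v ≥ 1` on `F`) and `ε > 0`, test the equation with `|v|^p
(u + ε)^{1-p}`. As `0 ≤ u ≤ 1`, this function is at least `(1 + ε)^{1-p}` on `F`, while the discrete
Picone inequality (`picone`) bounds its pairing with `u` by the `k`-energy of `v`, hence by `Λ`
times the Gagliardo energy. Letting `ε → 0` and minimising over `v` gives the claim.

The difficulty is that `u` is controlled only a.e. for Lebesgue measure, whereas `μ` may be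
singular. So `u` is replaced inside the test function by smooth `w_j → u`, truncated to `[0, 1]`:
the lower bound on `F` then holds at every point for each `j`, and the limit is taken only on the
energy side (`tendsto_integral_signedPow_mul`). The same scheme proves `0 ≤ u ≤ 1`
(`potential_mem_Icc`). Such test functions are merely Lipschitz, and `integral_eq_form_of_isLipTest`
admits them. -/

/-- The difference `(x, y) ↦ w(x) - w(y)`. -/
def diff (w : Rn n → ℝ) (z : Rn n × Rn n) : ℝ := w z.1 - w z.2

/-- The measure `k(x,y) dx dy`. -/
def kernelMeasure (k : Rn n → Rn n → ℝ≥0∞) : Measure (Rn n × Rn n) :=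
  (volume.prod volume).withDensity (fun z => k z.1 z.2)

/-- The monotone function `t ↦ |t|^{p-2} t`. -/
def signedPow (p t : ℝ) : ℝ := |t| ^ (p - 2) * t

/-! ### The measure `k dx dy` and `p`-integrability of differences -/

theorem kernelMeasure_absolutelyContinuous (k : Rn n → Rn n → ℝ≥0∞) :
    kernelMeasure k ≪ volume.prod volume := withDensity_absolutelyContinuous _ _

theorem nontrivial_Rn (hn : 0 < n) : Nontrivial (Rn n) := by
  have : Nonempty (Fin n) := ⟨⟨0, hn⟩⟩
  infer_instance

/-- In polar coordinates the radial exponent is `p - 1 - sp > -1` near the origin, because `s < 1`,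
and `-1 - sp < -1` at infinity, because `s > 0`. -/
theorem integrable_min_norm_rpow (hn : 0 < n) {s p : ℝ} (hs0 : 0 < s) (hs1 : s < 1) (hp : 1 < p) :
    Integrable (fun z : Rn n => (min 1 ‖z‖) ^ p / ‖z‖ ^ ((n : ℝ) + s * p)) := by
  have := nontrivial_Rn hn
  have hfr : Module.finrank ℝ (Rn n) = n := by simp
  rw [integrable_fun_norm_addHaar volume (f := fun r => (min 1 r) ^ p / r ^ ((n : ℝ) + s * p)), hfr]
  have hsp : 0 < s * p := by positivity
  have hcast : ((n - 1 : ℕ) : ℝ) = (n : ℝ) - 1 := by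
    rw [Nat.cast_sub hn]; simp
  rw [← Ioc_union_Ioi_eq_Ioi (zero_le_one' ℝ), integrableOn_union]
  constructor
  · have h1 : IntegrableOn (fun y : ℝ => y ^ (p - 1 - s * p)) (Ioc 0 1) := by
      have := (intervalIntegral.intervalIntegrable_rpow' (a := 0) (b := 1)
        (r := p - 1 - s * p) (by nlinarith))
      rwa [intervalIntegrable_iff_integrableOn_Ioc_of_le zero_le_one] at this
    refine h1.congr_fun (fun y hy => ?_) measurableSet_Ioc
    have hy0 : 0 < y := hy.1
    simp only [min_eq_right hy.2, smul_eq_mul]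
    rw [← Real.rpow_natCast, hcast, ← Real.rpow_sub hy0, ← Real.rpow_add hy0]
    congr 1; ring
  · have h1 : IntegrableOn (fun y : ℝ => y ^ (-1 - s * p)) (Ioi 1) :=
      integrableOn_Ioi_rpow_of_lt (by linarith) zero_lt_one
    refine h1.congr_fun (fun y hy => ?_) measurableSet_Ioi
    have hy1 : 1 < y := hy
    have hy0 : 0 < y := by linarith
    simp only [min_eq_left hy1.le, smul_eq_mul]
    rw [← Real.rpow_natCast, hcast, Real.one_rpow, one_div, ← Real.rpow_neg hy0.le,
      ← Real.rpow_add hy0]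
    congr 1; ring

theorem ae_fst_ne_snd (hn : 0 < n) :
    ∀ᵐ z : Rn n × Rn n ∂(volume.prod volume), z.1 ≠ z.2 := by
  have := nontrivial_Rn hn
  have hm : MeasurableSet {z : Rn n × Rn n | z.1 ≠ z.2} :=
    (measurableSet_eq_fun measurable_fst measurable_snd).compl
  rw [Measure.ae_prod_iff_ae_ae hm]
  filter_upwards with x
  have : ∀ᵐ y : Rn n, y ≠ x := by simp [ae_iff]
  filter_upwards [this] with y hy using hy.symm

theorem measurable_kernel {s p Λ : ℝ} {k : Rn n → Rn n → ℝ≥0∞} (hk : IsEllipticKernel s p Λ k) :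
    Measurable (fun z : Rn n × Rn n => k z.1 z.2) := hk.measurable

theorem aestronglyMeasurable_diff {w : Rn n → ℝ} (hw : AEStronglyMeasurable w volume) :
    AEStronglyMeasurable (diff w) (volume.prod volume) :=
  hw.comp_fst.sub hw.comp_snd

/-- The factor `Λ` of the theorem arises here, from the upper bound on `k` off the null diagonal. -/
theorem lintegral_kernelMeasure_le (hn : 0 < n) {s p Λ : ℝ}
    {k : Rn n → Rn n → ℝ≥0∞} (hk : IsEllipticKernel s p Λ k) (f : Rn n × Rn n → ℝ≥0∞)
    (hf : AEMeasurable f (volume.prod volume)) :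
    ∫⁻ z, f z ∂(kernelMeasure k) ≤ ENNReal.ofReal Λ *
      ∫⁻ x, ∫⁻ y, f (x, y) / ‖x - y‖ₑ ^ ((n : ℝ) + s * p) := by
  have hm : AEMeasurable (fun z : Rn n × Rn n => f z / ‖z.1 - z.2‖ₑ ^ ((n : ℝ) + s * p))
      (volume.prod volume) := by
    refine hf.div (Measurable.aemeasurable ?_)
    fun_prop
  rw [kernelMeasure, lintegral_withDensity_eq_lintegral_mul₀ (measurable_kernel hk).aemeasurable hf,
    ← lintegral_prod _ hm, ← lintegral_const_mul'' _ hm]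
  refine lintegral_mono_ae ?_
  filter_upwards [ae_fst_ne_snd hn] with z hz
  have h0 : 0 < ‖z.1 - z.2‖ := norm_pos_iff.2 (sub_ne_zero.2 hz)
  have h1 := hk.upper z.1 z.2 hz
  rw [ENNReal.ofReal_div_of_pos (by positivity), ← ENNReal.ofReal_rpow_of_pos h0,
    ofReal_norm] at h1
  simp only [Pi.mul_apply]
  calc k z.1 z.2 * f z ≤ (ENNReal.ofReal Λ / ‖z.1 - z.2‖ₑ ^ ((n : ℝ) + s * p)) * f z := by gcongr
    _ = _ := by rw [div_eq_mul_inv, div_eq_mul_inv]; ring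

theorem lintegral_diff_le (hn : 0 < n) {s p Λ : ℝ}
    {k : Rn n → Rn n → ℝ≥0∞} (hk : IsEllipticKernel s p Λ k) {w : Rn n → ℝ}
    (hw : AEStronglyMeasurable w volume) :
    ∫⁻ z, ‖diff w z‖ₑ ^ p ∂(kernelMeasure k) ≤ ENNReal.ofReal Λ * gagliardo s p univ w := by
  refine (lintegral_kernelMeasure_le hn hk _
    ((aestronglyMeasurable_diff hw).enorm.pow_const p)).trans ?_
  simp [gagliardo, diff]

theorem memLp_of_lintegral_lt_top {α : Type*} [MeasurableSpace α] {ν : Measure α} {p : ℝ}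
    (hp : 1 < p) {f : α → ℝ} (hf : AEStronglyMeasurable f ν)
    (h : ∫⁻ z, ‖f z‖ₑ ^ p ∂ν < ⊤) : MemLp f (ENNReal.ofReal p) ν := by
  refine ⟨hf, ?_⟩
  rw [eLpNorm_lt_top_iff_lintegral_rpow_enorm_lt_top (by simp; linarith) (by simp),
    ENNReal.toReal_ofReal (by linarith)]
  exact h

theorem memLp_diff_of_gagliardo (hn : 0 < n) {s p Λ : ℝ} (hp : 1 < p)
    {k : Rn n → Rn n → ℝ≥0∞} (hk : IsEllipticKernel s p Λ k) {w : Rn n → ℝ}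
    (hw : AEStronglyMeasurable w volume) (h : gagliardo s p univ w < ⊤) :
    MemLp (diff w) (ENNReal.ofReal p) (kernelMeasure k) :=
  memLp_of_lintegral_lt_top hp
    ((aestronglyMeasurable_diff hw).mono_ac (kernelMeasure_absolutelyContinuous k))
    ((lintegral_diff_le hn hk hw).trans_lt (ENNReal.mul_lt_top (by simp) h))

/-- `(1_S(x) + 1_S(y)) min(1, |x - y|)`. -/
def cutoffDist (S : Set (Rn n)) (z : Rn n × Rn n) : ℝ :=
  (S.indicator 1 z.1 + S.indicator 1 z.2) * min 1 ‖z.1 - z.2‖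

theorem lintegral_min_norm_lt_top (hn : 0 < n) {s p : ℝ} (hs0 : 0 < s) (hs1 : s < 1)
    (hp : 1 < p) :
    ∫⁻ z : Rn n, ‖min 1 ‖z‖‖ₑ ^ p / ‖z‖ₑ ^ ((n : ℝ) + s * p) < ⊤ := by
  refine lt_of_le_of_lt (lintegral_mono_ae ?_) (integrable_min_norm_rpow hn hs0 hs1 hp).2
  have := nontrivial_Rn hn
  have h0 : ∀ᵐ y : Rn n, y ≠ 0 := by simp [ae_iff]
  filter_upwards [h0] with z hz
  have hz0 : 0 < ‖z‖ := norm_pos_iff.2 hz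
  have hm : 0 < min 1 ‖z‖ := by positivity
  rw [Real.enorm_of_nonneg (r := _ / _) (by positivity), ENNReal.ofReal_div_of_pos (by positivity),
    ← ENNReal.ofReal_rpow_of_pos hz0, ← ENNReal.ofReal_rpow_of_pos hm, ofReal_norm,
    Real.enorm_of_nonneg hm.le]

/-- Integrating first in the variable not confined to `S` gives, by translation invariance, a finite
constant; the other variable contributes the volume of `S`. -/
theorem memLp_cutoffDist (hn : 0 < n) {s p Λ : ℝ} (hs0 : 0 < s) (hs1 : s < 1) (hp : 1 < p)
    {k : Rn n → Rn n → ℝ≥0∞} (hk : IsEllipticKernel s p Λ k) {S : Set (Rn n)}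
    (hS : IsCompact S) :
    MemLp (cutoffDist S) (ENNReal.ofReal p) (kernelMeasure k) := by
  have hSm := hS.measurableSet
  have hmi : Measurable (S.indicator (1 : Rn n → ℝ)) := measurable_one.indicator hSm
  -- Here `f` is either projection, so both summands of `cutoffDist` are covered.
  have key : ∀ f : Rn n × Rn n → Rn n, Measurable f →
      ∫⁻ x, ∫⁻ y, ‖S.indicator (1 : Rn n → ℝ) (f (x, y))‖ₑ ^ p *
        (‖min 1 ‖x - y‖‖ₑ ^ p / ‖x - y‖ₑ ^ ((n : ℝ) + s * p)) < ⊤ →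
      MemLp (fun z : Rn n × Rn n => S.indicator (1 : Rn n → ℝ) (f z) * min 1 ‖z.1 - z.2‖)
        (ENNReal.ofReal p) (kernelMeasure k) := by
    intro f hf h
    have hmeas : Measurable (fun z : Rn n × Rn n =>
        S.indicator (1 : Rn n → ℝ) (f z) * min 1 ‖z.1 - z.2‖) :=
      (hmi.comp hf).mul (by fun_prop)
    refine memLp_of_lintegral_lt_top hp hmeas.aestronglyMeasurable ?_
    refine (lintegral_kernelMeasure_le hn hk _ (hmeas.enorm.pow_const p).aemeasurable).trans_lt
      (ENNReal.mul_lt_top (by simp) (lt_of_le_of_lt (le_of_eq ?_) h))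
    congr with x
    congr with y
    rw [enorm_mul, ENNReal.mul_rpow_of_nonneg _ _ (by linarith), mul_div_assoc]
  have hind : ∫⁻ x, ‖S.indicator (1 : Rn n → ℝ) x‖ₑ ^ p < ⊤ := by
    have : (fun x => ‖S.indicator (1 : Rn n → ℝ) x‖ₑ ^ p) = S.indicator 1 := by
      ext x
      by_cases hx : x ∈ S
      · simp [hx]
      · simp [hx, show 0 < p by linarith]
    rw [this, lintegral_indicator_one hSm]
    exact hS.measure_lt_top
  have hC := lintegral_min_norm_lt_top hn hs0 hs1 hp
  have hmeasN : Measurable (fun z : Rn n => ‖min 1 ‖z‖‖ₑ ^ p / ‖z‖ₑ ^ ((n : ℝ) + s * p)) := by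
    fun_prop
  have h1 := key Prod.fst measurable_fst (by
    simp only
    have : ∀ x : Rn n, ∫⁻ y, ‖S.indicator (1 : Rn n → ℝ) x‖ₑ ^ p *
        (‖min 1 ‖x - y‖‖ₑ ^ p / ‖x - y‖ₑ ^ ((n : ℝ) + s * p)) =
        ‖S.indicator (1 : Rn n → ℝ) x‖ₑ ^ p *
          ∫⁻ z : Rn n, ‖min 1 ‖z‖‖ₑ ^ p / ‖z‖ₑ ^ ((n : ℝ) + s * p) := by
      intro x
      rw [lintegral_const_mul _ (by fun_prop),
        lintegral_sub_left_eq_self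
          (fun z : Rn n => ‖min 1 ‖z‖‖ₑ ^ p / ‖z‖ₑ ^ ((n : ℝ) + s * p)) x]
    simp only [this]
    rw [lintegral_mul_const _ (by fun_prop)]
    exact ENNReal.mul_lt_top hind hC)
  have h2 := key Prod.snd measurable_snd (by
    simp only
    rw [lintegral_lintegral_swap]
    · have : ∀ y : Rn n, ∫⁻ x, ‖S.indicator (1 : Rn n → ℝ) y‖ₑ ^ p *
          (‖min 1 ‖x - y‖‖ₑ ^ p / ‖x - y‖ₑ ^ ((n : ℝ) + s * p)) =
          ‖S.indicator (1 : Rn n → ℝ) y‖ₑ ^ p *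
            ∫⁻ z : Rn n, ‖min 1 ‖z‖‖ₑ ^ p / ‖z‖ₑ ^ ((n : ℝ) + s * p) := by
        intro y
        rw [lintegral_const_mul _ (by fun_prop),
          lintegral_sub_right_eq_self
            (fun z : Rn n => ‖min 1 ‖z‖‖ₑ ^ p / ‖z‖ₑ ^ ((n : ℝ) + s * p)) y]
      simp only [this]
      rw [lintegral_mul_const _ (by fun_prop)]
      exact ENNReal.mul_lt_top hind hC
    · refine Measurable.aemeasurable ?_
      exact ((hmi.comp measurable_snd).enorm.pow_const p).mul
        (hmeasN.comp (measurable_fst.sub measurable_snd)))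
  convert h1.add h2 using 1
  ext z
  simp only [cutoffDist, Pi.add_apply]
  ring

/-- One majorant serves a whole family of functions with common support, Lipschitz constant and
bound: `L` is used at distance below `1`, `2 * M` above. -/
theorem abs_diff_le_cutoffDist {g : Rn n → ℝ} {S : Set (Rn n)} {L M : ℝ}
    (hL : ∀ x y, |g x - g y| ≤ L * ‖x - y‖) (hM : ∀ x, |g x| ≤ M) (hS : ∀ x, x ∉ S → g x = 0)
    (z : Rn n × Rn n) : |diff g z| ≤ (max L (2 * M)) * cutoffDist S z := by
  have hM0 : 0 ≤ M := (abs_nonneg _).trans (hM 0)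
  have hmax : 0 ≤ max L (2 * M) := le_max_of_le_right (by linarith)
  have hmin : |diff g z| ≤ max L (2 * M) * min 1 ‖z.1 - z.2‖ := by
    rw [mul_min_of_nonneg _ _ hmax, mul_one]
    refine le_min ?_ ((hL _ _).trans (by gcongr; exact le_max_left _ _))
    refine (abs_sub _ _).trans ?_
    linarith [hM z.1, hM z.2, le_max_right L (2 * M)]
  have hmin0 : 0 ≤ min 1 ‖z.1 - z.2‖ := by positivity
  have hnn : ∀ x, 0 ≤ S.indicator (1 : Rn n → ℝ) x := fun x =>
    indicator_nonneg (fun _ _ => zero_le_one) x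
  by_cases h1 : z.1 ∈ S
  · refine hmin.trans ?_
    rw [cutoffDist]
    gcongr
    have := hnn z.2
    have h1' : S.indicator (1 : Rn n → ℝ) z.1 = 1 := by simp [h1]
    nlinarith
  by_cases h2 : z.2 ∈ S
  · refine hmin.trans ?_
    rw [cutoffDist]
    gcongr
    have := hnn z.1
    have h1' : S.indicator (1 : Rn n → ℝ) z.2 = 1 := by simp [h2]
    nlinarith
  · simp [diff, hS _ h1, hS _ h2, cutoffDist, h1, h2]

/-- Lipschitz functions with compact support in `U`. -/
structure IsLipTest (U : Set (Rn n)) (g : Rn n → ℝ) : Prop where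
  lipschitz : ∃ C, LipschitzWith C g
  compact : HasCompactSupport g
  support_subset : tsupport g ⊆ U

theorem IsTest.isLipTest {U : Set (Rn n)} {g : Rn n → ℝ} (h : IsTest U g) : IsLipTest U g :=
  ⟨⟨_, (ContDiff.lipschitzWith_of_hasCompactSupport h.compact h.smooth (by simp)).choose_spec⟩,
    h.compact, h.support_subset⟩

theorem IsLipTest.continuous {U : Set (Rn n)} {g : Rn n → ℝ} (h : IsLipTest U g) :
    Continuous g := h.lipschitz.choose_spec.continuous

theorem memLp_diff_of_bound (hn : 0 < n) {s p Λ : ℝ} (hs0 : 0 < s) (hs1 : s < 1) (hp : 1 < p)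
    {k : Rn n → Rn n → ℝ≥0∞} (hk : IsEllipticKernel s p Λ k) {U : Set (Rn n)} {g : Rn n → ℝ}
    (hg : IsLipTest U g) : MemLp (diff g) (ENNReal.ofReal p) (kernelMeasure k) := by
  obtain ⟨C, hC⟩ := hg.lipschitz
  obtain ⟨M, hM⟩ := hg.compact.exists_bound_of_continuous hg.continuous
  refine ((memLp_cutoffDist hn hs0 hs1 hp hk hg.compact).const_mul (max C (2 * M))).mono' ?_ ?_
  · exact ((aestronglyMeasurable_diff hg.continuous.aestronglyMeasurable).mono_ac
      (kernelMeasure_absolutelyContinuous k))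
  · filter_upwards with z
    refine abs_diff_le_cutoffDist (fun x y => ?_) hM (fun x hx => image_eq_zero_of_notMem_tsupport hx) z
    have := hC.dist_le_mul x y
    rwa [Real.dist_eq, dist_eq_norm] at this


/-! ### Hölder's inequality and passage to the limit for `|t|^{p-2} t` -/

theorem abs_signedPow {p : ℝ} (hp : 1 < p) (t : ℝ) : |signedPow p t| = |t| ^ (p - 1) := by
  rcases eq_or_ne t 0 with rfl | ht
  · simp [signedPow, Real.zero_rpow (by linarith : p - 1 ≠ 0)]
  · have h : 0 < |t| := abs_pos.2 ht
    rw [signedPow, abs_mul, abs_of_nonneg (by positivity)]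
    nth_rewrite 2 [← Real.rpow_one |t|]
    rw [← Real.rpow_add h]
    congr 1; ring

theorem measurable_signedPow (p : ℝ) : Measurable (signedPow p) := by
  unfold signedPow
  exact ((measurable_norm (α := ℝ)).pow_const (p - 2)).mul measurable_id

theorem signedPow_neg (p t : ℝ) : signedPow p (-t) = -signedPow p t := by
  simp [signedPow]

theorem signedPow_of_nonneg {p : ℝ} (hp : 1 < p) {t : ℝ} (ht : 0 ≤ t) :
    signedPow p t = t ^ (p - 1) := by
  rw [← abs_of_nonneg (a := signedPow p t) (by unfold signedPow; positivity), abs_signedPow hp,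
    abs_of_nonneg ht]

theorem lintegral_signedPow_mul_le {α : Type*} [MeasurableSpace α] {ν : Measure α} {p : ℝ}
    (hp : 1 < p) {f h : α → ℝ} (hf : AEStronglyMeasurable f ν) (hh : AEStronglyMeasurable h ν) :
    ∫⁻ z, ‖signedPow p (f z) * h z‖ₑ ∂ν ≤
      (∫⁻ z, ‖f z‖ₑ ^ p ∂ν) ^ (1 - 1 / p) * (∫⁻ z, ‖h z‖ₑ ^ p ∂ν) ^ (1 / p) := by
  have hpq := (Real.HolderConjugate.conjExponent hp).symm
  have h1 : ∀ z, ‖signedPow p (f z)‖ₑ = ‖f z‖ₑ ^ (p - 1) := by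
    intro z
    rw [Real.enorm_eq_ofReal_abs, abs_signedPow hp, Real.enorm_eq_ofReal_abs,
      ENNReal.ofReal_rpow_of_nonneg (abs_nonneg _) (by linarith)]
  have := ENNReal.lintegral_mul_le_Lp_mul_Lq ν hpq (f := fun z => ‖signedPow p (f z)‖ₑ)
    (g := fun z => ‖h z‖ₑ) (((measurable_signedPow p).comp_aemeasurable hf.aemeasurable).enorm)
    hh.enorm
  simp only [Pi.mul_apply, ← enorm_mul] at this
  refine this.trans (le_of_eq ?_)
  have hp1 : p - 1 ≠ 0 := by linarith
  have hp0 : p ≠ 0 := by linarith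
  congr 1
  · congr 1
    · congr with z
      rw [h1, ← ENNReal.rpow_mul]
      congr 1
      rw [Real.conjExponent]; field_simp
    · rw [Real.conjExponent]; field_simp

theorem MemLp.lintegral_rpow_lt_top {α : Type*} [MeasurableSpace α] {ν : Measure α} {p : ℝ}
    (hp : 1 < p) {f : α → ℝ} (hf : MemLp f (ENNReal.ofReal p) ν) :
    ∫⁻ z, ‖f z‖ₑ ^ p ∂ν < ⊤ := by
  have := hf.2
  rwa [eLpNorm_lt_top_iff_lintegral_rpow_enorm_lt_top (by simp; linarith) (by simp),
    ENNReal.toReal_ofReal (by linarith)] at this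

theorem integrable_signedPow_mul {α : Type*} [MeasurableSpace α] {ν : Measure α} {p : ℝ}
    (hp : 1 < p) {f h : α → ℝ} (hf : MemLp f (ENNReal.ofReal p) ν)
    (hh : MemLp h (ENNReal.ofReal p) ν) : Integrable (fun z => signedPow p (f z) * h z) ν := by
  refine ⟨(((measurable_signedPow p).comp_aemeasurable
    hf.1.aemeasurable).aestronglyMeasurable).mul hh.1, ?_⟩
  refine (lintegral_signedPow_mul_le hp hf.1 hh.1).trans_lt (ENNReal.mul_lt_top ?_ ?_)
  · exact ENNReal.rpow_lt_top_of_nonneg (sub_nonneg.2 ((div_le_one (by linarith)).2 hp.le))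
      (MemLp.lintegral_rpow_lt_top hp hf).ne
  · exact ENNReal.rpow_lt_top_of_nonneg (by positivity) (MemLp.lintegral_rpow_lt_top hp hh).ne

/-- Generalised dominated convergence: the majorant `H + C |F j|` varies with `j`, but `F j → f` in
`L^p`. It allows `h j` to be a Lipschitz function of the approximations of `u`, where no fixed
majorant is at hand. -/
theorem tendsto_integral_signedPow_mul {α : Type*} [MeasurableSpace α] {ν : Measure α} {p : ℝ}
    (hp : 1 < p) {f g H : α → ℝ} {F h : ℕ → α → ℝ} {C : ℝ} (hC : 0 ≤ C)
    (hf : MemLp f (ENNReal.ofReal p) ν) (hH : MemLp H (ENNReal.ofReal p) ν)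
    (hF : ∀ j, MemLp (F j) (ENNReal.ofReal p) ν)
    (hFae : ∀ᵐ z ∂ν, Tendsto (fun j => F j z) atTop (𝓝 (f z)))
    (hFlp : Tendsto (fun j => ∫⁻ z, ‖F j z - f z‖ₑ ^ p ∂ν) atTop (𝓝 0))
    (hh : ∀ j, AEStronglyMeasurable (h j) ν)
    (hhae : ∀ᵐ z ∂ν, Tendsto (fun j => h j z) atTop (𝓝 (g z)))
    (hbd : ∀ j z, |h j z| ≤ H z + C * |F j z|) :
    MemLp g (ENNReal.ofReal p) ν ∧
    Tendsto (fun j => ∫ z, signedPow p (f z) * h j z ∂ν) atTop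
      (𝓝 (∫ z, signedPow p (f z) * g z ∂ν)) := by
  have hgm : AEStronglyMeasurable g ν := aestronglyMeasurable_of_tendsto_ae atTop hh hhae
  have hgb : ∀ᵐ z ∂ν, |g z| ≤ H z + C * |f z| := by
    filter_upwards [hFae, hhae] with z h1 h2
    exact le_of_tendsto_of_tendsto' h2.abs (tendsto_const_nhds.add (h1.abs.const_mul C))
      (fun j => hbd j z)
  have hgp : MemLp g (ENNReal.ofReal p) ν :=
    (hH.add (hf.abs.const_mul C)).mono' hgm hgb
  have hhp : ∀ j, MemLp (h j) (ENNReal.ofReal p) ν := fun j =>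
    (hH.add ((hF j).abs.const_mul C)).mono' (hh j) (Eventually.of_forall (hbd j))
  refine ⟨hgp, ?_⟩
  have hJm : AEMeasurable (fun z => signedPow p (f z)) ν :=
    (measurable_signedPow p).comp_aemeasurable hf.1.aemeasurable
  -- Adding the bounds for `h j` and `g` and using `|F j| ≤ |F j - f| + |f|` gives `|h j - g| ≤ B +
  -- C |F j - f|`.
  set B : α → ℝ := fun z => 2 * H z + 2 * C * |f z| with hB
  have hBp : MemLp B (ENNReal.ofReal p) ν := (hH.const_mul 2).add (hf.abs.const_mul (2 * C))
  refine tendsto_integral_of_L1' _ (integrable_signedPow_mul hp hf hgp).1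
    (Eventually.of_forall fun j => integrable_signedPow_mul hp hf (hhp j)) ?_
  simp only [eLpNorm_one_eq_lintegral_enorm]
  -- The part below the fixed majorant vanishes by dominated convergence; the overshoot is
  -- controlled by `F j - f` and vanishes by Hölder.
  have hsplit : ∀ j, ∫⁻ z, ‖((fun z => signedPow p (f z) * h j z) -
      fun z => signedPow p (f z) * g z) z‖ₑ ∂ν ≤
      (∫⁻ z, min ‖signedPow p (f z) * (h j z - g z)‖ₑ ‖signedPow p (f z) * B z‖ₑ ∂ν) +
        ENNReal.ofReal C * ∫⁻ z, ‖signedPow p (f z) * (F j z - f z)‖ₑ ∂ν := by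
    intro j
    have hm : AEMeasurable (fun z => ‖signedPow p (f z) * (F j z - f z)‖ₑ) ν :=
      (hJm.mul ((hF j).1.sub hf.1).aemeasurable).enorm
    rw [← lintegral_const_mul'' _ hm, ← lintegral_add_right' _ (hm.const_mul _)]
    refine lintegral_mono_ae ?_
    filter_upwards [hgb] with z hz
    simp only [Pi.sub_apply, ← mul_sub, enorm_mul]
    have h1 : |h j z - g z| ≤ |B z| + C * |F j z - f z| := by
      have h2 := hbd j z
      have h3 : |F j z| ≤ |F j z - f z| + |f z| := by
        have := abs_add_le (F j z - f z) (f z); simpa using this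
      have h4 := abs_sub (h j z) (g z)
      have h5 := le_abs_self (B z)
      have h6 : B z = 2 * H z + 2 * C * |f z| := rfl
      nlinarith [mul_le_mul_of_nonneg_left h3 hC]
    have h2 : ‖h j z - g z‖ₑ ≤ ‖B z‖ₑ + ENNReal.ofReal C * ‖F j z - f z‖ₑ := by
      rw [Real.enorm_eq_ofReal_abs, Real.enorm_eq_ofReal_abs, Real.enorm_eq_ofReal_abs,
        ← ENNReal.ofReal_mul hC, ← ENNReal.ofReal_add (by positivity) (by positivity)]
      exact ENNReal.ofReal_le_ofReal h1
    rcases le_total (‖signedPow p (f z)‖ₑ * ‖h j z - g z‖ₑ)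
      (‖signedPow p (f z)‖ₑ * ‖B z‖ₑ) with hle | hle
    · rw [min_eq_left hle]; exact le_self_add
    · rw [min_eq_right hle]
      calc _ ≤ ‖signedPow p (f z)‖ₑ * (‖B z‖ₑ + ENNReal.ofReal C * ‖F j z - f z‖ₑ) := by gcongr
        _ = _ := by ring
  refine tendsto_of_tendsto_of_tendsto_of_le_of_le tendsto_const_nhds ?_ (fun j => zero_le)
    hsplit
  have hBi : ∫⁻ z, ‖signedPow p (f z) * B z‖ₑ ∂ν ≠ ⊤ := (integrable_signedPow_mul hp hf hBp).2.ne
  rw [show (0 : ℝ≥0∞) = 0 + ENNReal.ofReal C * 0 by simp]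
  refine Tendsto.add ?_ (ENNReal.Tendsto.const_mul ?_ (Or.inr ENNReal.ofReal_ne_top))
  · have := tendsto_lintegral_of_dominated_convergence' (μ := ν)
      (F := fun j z => min ‖signedPow p (f z) * (h j z - g z)‖ₑ ‖signedPow p (f z) * B z‖ₑ)
      (f := fun _ => 0) (fun z => ‖signedPow p (f z) * B z‖ₑ)
      (fun j => ((hJm.mul ((hh j).sub hgm).aemeasurable).enorm).min
        ((hJm.mul hBp.1.aemeasurable).enorm))
      (fun j => Eventually.of_forall fun z => min_le_right _ _) hBi ?_
    · simpa using this
    · filter_upwards [hhae] with z hz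
      have h1 : Tendsto (fun j => ‖signedPow p (f z) * (h j z - g z)‖ₑ) atTop (𝓝 0) := by
        have := ((hz.sub_const (g z)).const_mul (signedPow p (f z))).enorm
        simpa using this
      exact tendsto_of_tendsto_of_tendsto_of_le_of_le tendsto_const_nhds h1
        (fun j => zero_le) (fun j => min_le_left _ _)
  · have hA := MemLp.lintegral_rpow_lt_top hp hf
    have hlim : Tendsto (fun j => (∫⁻ z, ‖f z‖ₑ ^ p ∂ν) ^ (1 - 1 / p) *
        (∫⁻ z, ‖F j z - f z‖ₑ ^ p ∂ν) ^ (1 / p)) atTop (𝓝 0) := by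
      have h1 := (ENNReal.continuous_rpow_const (y := 1 / p)).tendsto 0 |>.comp hFlp
      rw [ENNReal.zero_rpow_of_pos (by positivity)] at h1
      have := ENNReal.Tendsto.const_mul (a := (∫⁻ z, ‖f z‖ₑ ^ p ∂ν) ^ (1 - 1 / p)) h1
        (Or.inr (ENNReal.rpow_lt_top_of_nonneg
          (sub_nonneg.2 ((div_le_one (by linarith)).2 hp.le)) hA.ne).ne)
      simpa using this
    exact tendsto_of_tendsto_of_tendsto_of_le_of_le tendsto_const_nhds hlim
      (fun j => zero_le) (fun j => lintegral_signedPow_mul_le hp hf.1 ((hF j).1.sub hf.1))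

theorem kernel_lt_top (hn : 0 < n) {s p Λ : ℝ}
    {k : Rn n → Rn n → ℝ≥0∞} (hk : IsEllipticKernel s p Λ k) :
    ∀ᵐ z : Rn n × Rn n ∂(volume.prod volume), k z.1 z.2 < ⊤ := by
  filter_upwards [ae_fst_ne_snd hn] with z hz
  exact (hk.upper _ _ hz).trans_lt ENNReal.ofReal_lt_top

theorem form_eq_integral (hn : 0 < n) {s p Λ : ℝ}
    {k : Rn n → Rn n → ℝ≥0∞} (hk : IsEllipticKernel s p Λ k) (u w : Rn n → ℝ) :
    form p k u w = ∫ z, signedPow p (diff u z) * diff w z ∂(kernelMeasure k) := by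
  rw [kernelMeasure, integral_withDensity_eq_integral_toReal_smul (measurable_kernel hk)
    (kernel_lt_top hn hk), form]
  congr with z
  simp only [formIntegrand, signedPow, diff, smul_eq_mul]
  ring

/-! ### The discrete Picone inequality -/

/-- Discrete Picone inequality. -/
theorem picone_of_le {p : ℝ} (hp : 1 < p) {a b c d : ℝ} (hb : 0 < b) (hab : b ≤ a)
    (hc : 0 ≤ c) (hd : 0 ≤ d) :
    signedPow p (a - b) * (c ^ p * a ^ (1 - p) - d ^ p * b ^ (1 - p)) ≤ |c - d| ^ p := by
  have ha : 0 < a := hb.trans_le hab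
  rw [signedPow_of_nonneg hp (by linarith)]
  rcases hab.eq_or_lt with rfl | hlt
  · rw [sub_self, Real.zero_rpow (by linarith), zero_mul]; positivity
  have hab0 : 0 < a - b := by linarith
  -- The weights `(a - b) / a` and `b / a` sum to one, and the points are chosen so that their mean
  -- is `|c - d| + d ≥ c`; convexity of `t ^ p` then bounds `c ^ p`.
  have hconv := (convexOn_rpow hp.le).2
    (show |c - d| * (a / (a - b)) ∈ Ici 0 by simp only [mem_Ici]; positivity)
    (show d * (a / b) ∈ Ici 0 by simp only [mem_Ici]; positivity)
    (show 0 ≤ (a - b) / a by positivity) (show 0 ≤ b / a by positivity) (by field_simp; ring)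
  simp only [smul_eq_mul] at hconv
  have h1 : (a - b) / a * (|c - d| * (a / (a - b))) + b / a * (d * (a / b)) = |c - d| + d := by
    field_simp
  rw [h1] at hconv
  have h2 : c ^ p ≤ (|c - d| + d) ^ p := by
    apply Real.rpow_le_rpow hc _ (by linarith)
    linarith [le_abs_self (c - d)]
  have h3 : c ^ p ≤ (a - b) / a * (|c - d| ^ p * (a / (a - b)) ^ p) +
      b / a * (d ^ p * (a / b) ^ p) := by
    rw [← Real.mul_rpow (by positivity) (by positivity),
      ← Real.mul_rpow (by positivity) (by positivity)]
    exact h2.trans hconv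
  have e1 : (a - b) / a * (a / (a - b)) ^ p = a ^ (p - 1) * (a - b) ^ (1 - p) := by
    rw [Real.div_rpow ha.le hab0.le, Real.rpow_sub_one ha.ne', Real.rpow_sub hab0, Real.rpow_one]
    field_simp
  have e2 : b / a * (a / b) ^ p = a ^ (p - 1) * b ^ (1 - p) := by
    rw [Real.div_rpow ha.le hb.le, Real.rpow_sub_one ha.ne', Real.rpow_sub hb, Real.rpow_one]
    field_simp
  have e3 : a ^ (p - 1) * a ^ (1 - p) = 1 := by
    rw [← Real.rpow_add ha]; simp
  have e4 : (a - b) ^ (p - 1) * (a - b) ^ (1 - p) = 1 := by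
    rw [← Real.rpow_add hab0]; simp
  have h4 : c ^ p ≤ a ^ (p - 1) * (|c - d| ^ p * (a - b) ^ (1 - p) + d ^ p * b ^ (1 - p)) := by
    calc _ ≤ _ := h3
      _ = |c - d| ^ p * ((a - b) / a * (a / (a - b)) ^ p) +
          d ^ p * (b / a * (a / b) ^ p) := by ring
      _ = _ := by rw [e1, e2]; ring
  calc _ ≤ (a - b) ^ (p - 1) * (a ^ (p - 1) * (|c - d| ^ p * (a - b) ^ (1 - p) +
        d ^ p * b ^ (1 - p)) * a ^ (1 - p) - d ^ p * b ^ (1 - p)) := by gcongr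
    _ = (a ^ (p - 1) * a ^ (1 - p)) * ((a - b) ^ (p - 1) * (|c - d| ^ p * (a - b) ^ (1 - p) +
        d ^ p * b ^ (1 - p))) - (a - b) ^ (p - 1) * (d ^ p * b ^ (1 - p)) := by ring
    _ = ((a - b) ^ (p - 1) * (a - b) ^ (1 - p)) * |c - d| ^ p := by rw [e3]; ring
    _ = _ := by rw [e4, one_mul]

/-- Discrete Picone inequality. -/
theorem picone {p : ℝ} (hp : 1 < p) {a b c d : ℝ} (ha : 0 < a) (hb : 0 < b)
    (hc : 0 ≤ c) (hd : 0 ≤ d) :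
    signedPow p (a - b) * (c ^ p * a ^ (1 - p) - d ^ p * b ^ (1 - p)) ≤ |c - d| ^ p := by
  rcases le_total b a with h | h
  · exact picone_of_le hp hb h hc hd
  · have := picone_of_le hp ha h hd hc
    rw [abs_sub_comm, ← neg_sub b a, signedPow_neg]
    linarith


/-! ### Lipschitz test functions and the support of `μ` -/

/-- Mollification averages translates of `g`, so it keeps the Lipschitz constant; radii at most `δ`
keep all supports in one compact subset of `U`. -/
theorem exists_test_approx {U : Set (Rn n)} (hU : IsOpen U) {g : Rn n → ℝ}
    (hg : IsLipTest U g) :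
    ∃ (φ : ℕ → Rn n → ℝ) (S : Set (Rn n)) (L M : ℝ), IsCompact S ∧ S ⊆ U ∧
      (∀ j, IsTest U (φ j)) ∧ (∀ j x, x ∉ S → φ j x = 0) ∧
      (∀ j x y, |φ j x - φ j y| ≤ L * ‖x - y‖) ∧ (∀ j x, |φ j x| ≤ M) ∧
      ∀ x, Tendsto (fun j => φ j x) atTop (𝓝 (g x)) := by
  obtain ⟨C, hC⟩ := hg.lipschitz
  obtain ⟨M, hM⟩ := hg.compact.exists_bound_of_continuous hg.continuous
  have hgc := hg.continuous
  obtain ⟨δ, hδ, hδU⟩ := IsCompact.exists_cthickening_subset_open hg.compact hU hg.support_subset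
  have hr : ∀ j : ℕ, 0 < δ / ((j : ℝ) + 1) := fun j => by positivity
  have hrδ : ∀ j : ℕ, δ / ((j : ℝ) + 1) ≤ δ := fun j => by
    rw [div_le_iff₀ (by positivity)]; nlinarith [(Nat.cast_nonneg j : (0 : ℝ) ≤ j)]
  let ρ : ℕ → ContDiffBump (0 : Rn n) := fun j =>
    ⟨δ / ((j : ℝ) + 1) / 2, δ / ((j : ℝ) + 1), by have := hr j; positivity,
      by have := hr j; linarith⟩
  have hρ : ∀ j, (ρ j).rOut = δ / ((j : ℝ) + 1) := fun j => rfl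
  let φ : ℕ → Rn n → ℝ := fun j =>
    convolution ((ρ j).normed volume) g (ContinuousLinearMap.lsmul ℝ ℝ) volume
  have hdist : ∀ j x, dist (φ j x) (g x) ≤ C * (δ / ((j : ℝ) + 1)) := by
    intro j x
    refine (ρ j).dist_normed_convolution_le hgc.aestronglyMeasurable (fun y hy => ?_)
    refine (hC.dist_le_mul y x).trans ?_
    gcongr
    exact (Metric.mem_ball.1 hy).le
  have hsupp : ∀ j x, x ∉ Metric.cthickening δ (tsupport g) → φ j x = 0 := by
    intro j x hx
    have h0 : ∀ y ∈ Metric.ball x (ρ j).rOut, g y = 0 := by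
      intro y hy
      by_contra hne
      refine hx (Metric.mem_cthickening_of_dist_le x y δ _ (subset_tsupport g hne) ?_)
      rw [dist_comm]
      exact (Metric.mem_ball.1 hy).le.trans (hrδ j)
    have hx0 := h0 x (Metric.mem_ball_self (hr j))
    have := (ρ j).normed_convolution_eq_right (μ := volume) (g := g) (x₀ := x)
      (fun y hy => by rw [h0 y hy, hx0])
    rw [hx0] at this
    exact this
  have hts : ∀ j, tsupport (φ j) ⊆ Metric.cthickening δ (tsupport g) := fun j =>
    closure_minimal (fun x hx => by_contra fun h => hx (hsupp j x h)) Metric.isClosed_cthickening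
  have hcomp : IsCompact (Metric.cthickening δ (tsupport g)) := IsCompact.cthickening hg.compact
  have hint : ∀ j x, Integrable (fun t => (ρ j).normed volume t * g (x - t)) := by
    intro j x
    refine Continuous.integrable_of_hasCompactSupport ?_ ?_
    · exact (ρ j).continuous_normed.mul (hgc.comp (by fun_prop))
    · exact (ρ j).hasCompactSupport_normed.mul_right
  refine ⟨φ, Metric.cthickening δ (tsupport g), C, M + C * δ, hcomp, hδU, fun j => ⟨?_, ?_, ?_⟩,
    hsupp, ?_, ?_, ?_⟩
  · exact (ρ j).hasCompactSupport_normed.contDiff_convolution_left _ (ρ j).contDiff_normed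
      hgc.locallyIntegrable
  · exact hcomp.of_isClosed_subset (isClosed_tsupport _) (hts j)
  · exact (hts j).trans hδU
  · intro j x y
    have e : φ j x - φ j y = ∫ t, (ρ j).normed volume t * (g (x - t) - g (y - t)) := by
      simp only [φ, convolution_def, ContinuousLinearMap.lsmul_apply, smul_eq_mul]
      rw [← integral_sub (hint j x) (hint j y)]
      congr with t
      ring
    rw [e, ← Real.norm_eq_abs]
    refine (norm_integral_le_of_norm_le ((ρ j).integrable_normed.mul_const (C * ‖x - y‖))
      (Eventually.of_forall fun t => ?_)).trans (le_of_eq ?_)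
    · rw [norm_mul, Real.norm_of_nonneg ((ρ j).nonneg_normed t)]
      refine mul_le_mul_of_nonneg_left ?_ ((ρ j).nonneg_normed t)
      have := hC.dist_le_mul (x - t) (y - t)
      rwa [dist_eq_norm, dist_eq_norm, sub_sub_sub_cancel_right] at this
    · rw [integral_mul_const, (ρ j).integral_normed, one_mul]
  · intro j x
    have h1 := hdist j x
    rw [Real.dist_eq] at h1
    have h2 : C * (δ / ((j : ℝ) + 1)) ≤ C * δ := by gcongr; exact hrδ j
    have h3 := hM x
    rw [Real.norm_eq_abs] at h3
    have h4 := abs_add_le (φ j x - g x) (g x)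
    rw [sub_add_cancel] at h4
    linarith
  · intro x
    rw [tendsto_iff_dist_tendsto_zero]
    refine squeeze_zero (fun j => dist_nonneg) (fun j => hdist j x) ?_
    have : Tendsto (fun j : ℕ => (C : ℝ) * δ * (1 / ((j : ℝ) + 1))) atTop (𝓝 (C * δ * 0)) :=
      tendsto_one_div_add_atTop_nhds_zero_nat.const_mul _
    rw [mul_zero] at this
    refine this.congr fun j => ?_
    ring

theorem integral_eq_form_of_isLipTest (hn : 0 < n) {s p Λ : ℝ} (hs0 : 0 < s) (hs1 : s < 1)
    (hp : 1 < p) {k : Rn n → Rn n → ℝ≥0∞} (hk : IsEllipticKernel s p Λ k) {Ω : Set (Rn n)}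
    (hΩ : IsOpen Ω) {u : Rn n → ℝ} {μ : Measure (Rn n)} (hμ : IsDistribution p k Ω u μ)
    (hu : MemLp (diff u) (ENNReal.ofReal p) (kernelMeasure k)) {g : Rn n → ℝ}
    (hg : IsLipTest Ω g) : ∫ x in Ω, g x ∂μ = form p k u g := by
  obtain ⟨φ, S, L, M, hS, hSΩ, hφ, hφS, hφL, hφM, hφg⟩ := exists_test_approx hΩ hg
  have h1 : Tendsto (fun j => form p k u (φ j)) atTop (𝓝 (form p k u g)) := by
    simp only [form_eq_integral hn hk]
    -- The majorant is fixed here, so `C = 0` and the auxiliary sequence is constant.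
    refine (tendsto_integral_signedPow_mul hp le_rfl hu
      ((memLp_cutoffDist hn hs0 hs1 hp hk hS).const_mul (max L (2 * M))) (fun _ => hu)
      (F := fun _ => diff u) (by simp) (by simp [show 0 < p by linarith]) (fun j => ?_)
      (Eventually.of_forall fun z => (hφg z.1).sub (hφg z.2)) (fun j z => ?_)).2
    · exact (aestronglyMeasurable_diff (hφ j).smooth.continuous.aestronglyMeasurable).mono_ac
        (kernelMeasure_absolutelyContinuous k)
    · rw [zero_mul, add_zero]
      exact abs_diff_le_cutoffDist (hφL j) (hφM j) (hφS j) z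
  have h2 : Tendsto (fun j => ∫ x in Ω, φ j x ∂μ) atTop (𝓝 (∫ x in Ω, g x ∂μ)) := by
    have hi : Integrable (S.indicator fun _ => M) (μ.restrict Ω) := by
      rw [integrable_indicator_iff hS.measurableSet]
      refine integrableOn_const (hs := ?_)
      exact ((Measure.restrict_apply_le _ _).trans_lt (hμ.finite_on_compacts S hS hSΩ)).ne
    refine tendsto_integral_of_dominated_convergence _
      (fun j => (hφ j).smooth.continuous.aestronglyMeasurable) hi
      (fun j => Eventually.of_forall fun x => ?_) (Eventually.of_forall fun x => hφg x)
    by_cases hx : x ∈ S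
    · simpa [hx] using hφM j x
    · simp [hφS j x hx, hx]
  refine tendsto_nhds_unique h2 ?_
  simpa only [(hμ.integral_eq _ (hφ _)).2] using h1

theorem IsWeakSolution.form_eq_zero {s p : ℝ} {k : Rn n → Rn n → ℝ≥0∞} {U : Set (Rn n)}
    {u : Rn n → ℝ} (hu : IsWeakSolution s p k U u) {φ : Rn n → ℝ} (hφ : IsTest U φ)
    (hφ0 : ∀ x, 0 ≤ φ x) : form p k u φ = 0 := by
  have h1 := (hu.1.form_nonneg φ hφ hφ0).2
  have h2 := (hu.2.form_nonneg φ hφ hφ0).2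
  have h3 : form p k (fun x => -u x) φ = -form p k u φ := by
    rw [form, form, ← integral_neg]
    congr with z
    simp only [formIntegrand]
    rw [← neg_sub' (u z.1) (u z.2), abs_neg]
    ring
  linarith

theorem IsTest.mono {U V : Set (Rn n)} (h : U ⊆ V) {φ : Rn n → ℝ} (hφ : IsTest U φ) :
    IsTest V φ := ⟨hφ.smooth, hφ.compact, hφ.support_subset.trans h⟩

theorem IsLipTest.mono {U V : Set (Rn n)} (h : U ⊆ V) {φ : Rn n → ℝ} (hφ : IsLipTest U φ) :
    IsLipTest V φ := ⟨hφ.lipschitz, hφ.compact, hφ.support_subset.trans h⟩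

theorem IsLipTest.integrable_restrict {p : ℝ} {k : Rn n → Rn n → ℝ≥0∞} {Ω : Set (Rn n)}
    {u : Rn n → ℝ} {μ : Measure (Rn n)} (hμ : IsDistribution p k Ω u μ) {g : Rn n → ℝ}
    (hg : IsLipTest Ω g) : Integrable g (μ.restrict Ω) := by
  obtain ⟨M, hM⟩ := hg.compact.exists_bound_of_continuous hg.continuous
  have hi : Integrable ((tsupport g).indicator fun _ => M) (μ.restrict Ω) := by
    rw [integrable_indicator_iff (isClosed_tsupport g).measurableSet]
    exact integrableOn_const (hs := ((Measure.restrict_apply_le _ _).trans_lt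
      (hμ.finite_on_compacts _ hg.compact hg.support_subset)).ne)
  refine hi.mono' hg.continuous.aestronglyMeasurable (Eventually.of_forall fun x => ?_)
  by_cases hx : x ∈ tsupport g
  · simpa [hx] using hM x
  · simp [image_eq_zero_of_notMem_tsupport hx, hx]

/-- A bump function equal to `1` on a small ball has zero `μ`-integral, so that ball is null; being
null is a local property. -/
theorem IsDistribution.measure_eq_zero {s p : ℝ} {k : Rn n → Rn n → ℝ≥0∞} {Ω U : Set (Rn n)}
    {u : Rn n → ℝ} {μ : Measure (Rn n)} (hμ : IsDistribution p k Ω u μ) (hU : IsOpen U)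
    (hUΩ : U ⊆ Ω) (hu : IsWeakSolution s p k U u) : μ U = 0 := by
  refine measure_null_of_locally_null _ fun x hx => ?_
  obtain ⟨r, hr, hrU⟩ := Metric.nhds_basis_closedBall.mem_iff.1 (hU.mem_nhds hx)
  let b : ContDiffBump x := ⟨r / 2, r, by positivity, by linarith⟩
  have hb : IsTest U b := ⟨b.contDiff, b.hasCompactSupport, by rw [b.tsupport_eq]; exact hrU⟩
  have h0 : ∫ y in Ω, b y ∂μ = 0 := by
    rw [(hμ.integral_eq b (hb.mono hUΩ)).2]
    exact hu.form_eq_zero hb (fun y => b.nonneg)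
  refine ⟨Metric.closedBall x (r / 2),
    mem_nhdsWithin_of_mem_nhds (Metric.closedBall_mem_nhds x (by positivity)), ?_⟩
  have hsub : Metric.closedBall x (r / 2) ⊆ Metric.closedBall x r :=
    Metric.closedBall_subset_closedBall (by linarith)
  have hi : Integrable b (μ.restrict Ω) := (hb.isLipTest.mono hUΩ).integrable_restrict hμ
  have hae := (integral_eq_zero_iff_of_nonneg (fun y => b.nonneg) hi).1 h0
  have hnull : (μ.restrict Ω) (Metric.closedBall x (r / 2)) = 0 := by
    refine measure_mono_null (fun y hy => ?_) hae
    simp only [mem_compl_iff, mem_ofPred_eq, Pi.zero_apply]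
    rw [b.one_of_mem_closedBall hy]
    exact one_ne_zero
  rwa [Measure.restrict_apply Metric.isClosed_closedBall.measurableSet,
    inter_eq_left.2 (hsub.trans (hrU.trans hUΩ))] at hnull

/-! ### Smooth approximation of the potential -/

/-- Take `w j = ψ + φ j` with `φ j` approximating `u - ψ` in the Sobolev norm. The `L^p` part of the
norm yields a.e. convergence along a subsequence, the Gagliardo part yields convergence of the
differences. That `w j = ψ` near `K` is kept for the truncation argument. -/
theorem exists_approx_of_isPotential (hn : 0 < n) {s p Λ : ℝ} (hs0 : 0 < s) (hs1 : s < 1)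
    (hp : 1 < p) {k : Rn n → Rn n → ℝ≥0∞} (hk : IsEllipticKernel s p Λ k) {K Ω : Set (Rn n)}
    {u : Rn n → ℝ} (hu : IsPotential s p k K Ω u) :
    AEStronglyMeasurable u volume ∧ MemLp (diff u) (ENNReal.ofReal p) (kernelMeasure k) ∧
    ∃ (ψ : Rn n → ℝ) (w : ℕ → Rn n → ℝ), (∀ x, ψ x ∈ Icc (0 : ℝ) 1) ∧ (∀ j, IsTest Ω (w j)) ∧
      (∀ j, tsupport (fun x => w j x - ψ x) ⊆ Ω \ K) ∧
      (∀ᵐ x, Tendsto (fun j => w j x) atTop (𝓝 (u x))) ∧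
      Tendsto (fun j => ∫⁻ z, ‖diff (w j) z - diff u z‖ₑ ^ p ∂(kernelMeasure k)) atTop (𝓝 0) := by
  obtain ⟨-, ψ, hψ, hψ01, -, ⟨⟨hm, hfin⟩, φ, hφ, hlim⟩⟩ := hu
  have hp0 : 0 < p := by linarith
  rw [Measure.restrict_univ] at hm
  have hψm : AEStronglyMeasurable ψ volume := hψ.smooth.continuous.aestronglyMeasurable
  have hum : AEStronglyMeasurable u volume := by
    refine (hm.add hψm).congr (Eventually.of_forall fun x => ?_)
    simp
  have hgag : gagliardo s p univ (fun x => u x - ψ x) < ⊤ := by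
    unfold sobolevNorm at hfin
    rw [ENNReal.rpow_lt_top_iff_of_pos (by positivity)] at hfin
    exact le_add_self.trans_lt hfin
  have hup : MemLp (diff u) (ENNReal.ofReal p) (kernelMeasure k) := by
    convert (memLp_diff_of_gagliardo hn hp hk hm hgag).add
      (memLp_diff_of_bound hn hs0 hs1 hp hk hψ.isLipTest) using 1
    ext z
    simp only [diff, Pi.add_apply]; ring
  have hlim' : Tendsto (fun j => (∫⁻ x, ‖u x - ψ x - φ j x‖ₑ ^ p) +
      gagliardo s p univ (fun x => u x - ψ x - φ j x)) atTop (𝓝 0) := by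
    have h1 := (ENNReal.continuous_rpow_const (y := p)).tendsto 0 |>.comp hlim
    rw [ENNReal.zero_rpow_of_pos hp0] at h1
    refine h1.congr fun j => ?_
    simp only [Function.comp, sobolevNorm, Measure.restrict_univ]
    rw [← ENNReal.rpow_mul, one_div, inv_mul_cancel₀ hp0.ne', ENNReal.rpow_one]
  let w : ℕ → Rn n → ℝ := fun j x => ψ x + φ j x
  have hsub : Ω \ K ⊆ Ω := sdiff_subset
  have hw : ∀ j, IsTest Ω (w j) := fun j =>
    ⟨hψ.smooth.add (hφ j).smooth, hψ.compact.add (hφ j).compact,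
      (tsupport_add ψ (φ j)).trans (union_subset hψ.support_subset
        ((hφ j).support_subset.trans hsub))⟩
  have hwm : ∀ j, AEStronglyMeasurable (w j) volume := fun j =>
    (hw j).smooth.continuous.aestronglyMeasurable
  have hL : Tendsto (fun j => eLpNorm (w j - u) (ENNReal.ofReal p) volume) atTop (𝓝 0) := by
    have h1 : Tendsto (fun j => (∫⁻ x, ‖u x - ψ x - φ j x‖ₑ ^ p)) atTop (𝓝 0) :=
      tendsto_of_tendsto_of_tendsto_of_le_of_le tendsto_const_nhds hlim' (fun j => zero_le)
        (fun j => le_self_add)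
    have h2 := (ENNReal.continuous_rpow_const (y := 1 / p)).tendsto 0 |>.comp h1
    rw [ENNReal.zero_rpow_of_pos (by positivity)] at h2
    refine h2.congr fun j => ?_
    rw [eLpNorm_eq_lintegral_rpow_enorm_toReal (by simp; linarith) (by simp),
      ENNReal.toReal_ofReal hp0.le]
    simp only [Function.comp]
    congr with x
    rw [← enorm_neg]
    simp only [w, Pi.sub_apply]
    congr 2
    ring
  obtain ⟨ns, hns, hae⟩ := (tendstoInMeasure_of_tendsto_eLpNorm (by simp; linarith)
    hwm hum hL).exists_seq_tendsto_ae
  refine ⟨hum, hup, ψ, fun j => w (ns j), hψ01, fun j => hw _, fun j => ?_, hae, ?_⟩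
  · have : (fun x => w (ns j) x - ψ x) = φ (ns j) := by ext x; simp [w]
    rw [this]
    exact (hφ _).support_subset
  · refine Tendsto.comp (g := fun j => ∫⁻ z, ‖diff (w j) z - diff u z‖ₑ ^ p ∂(kernelMeasure k)) ?_
      hns.tendsto_atTop
    have h1 : Tendsto (fun j => ENNReal.ofReal Λ *
        gagliardo s p univ (fun x => u x - ψ x - φ j x)) atTop (𝓝 (ENNReal.ofReal Λ * 0)) :=
      ENNReal.Tendsto.const_mul
        (tendsto_of_tendsto_of_tendsto_of_le_of_le tendsto_const_nhds hlim' (fun j => zero_le)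
        (fun j => le_add_self)) (Or.inr ENNReal.ofReal_ne_top)
    rw [mul_zero] at h1
    refine tendsto_of_tendsto_of_tendsto_of_le_of_le tendsto_const_nhds h1 (fun j => zero_le)
      (fun j => ?_)
    refine le_trans (le_of_eq ?_) (lintegral_diff_le hn hk
      (hm.sub (hφ j).smooth.continuous.aestronglyMeasurable))
    congr with z
    rw [← enorm_neg]
    congr 2
    simp only [diff, w]
    ring


/-! ### Truncation and the bounds `0 ≤ u ≤ 1` -/

theorem exists_lipschitzOnWith_of_contDiffAt {f : ℝ → ℝ} {S : Set ℝ} (hS : IsCompact S)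
    (hf : ∀ x ∈ S, ContDiffAt ℝ 1 f x) : ∃ C, LipschitzOnWith C f S := by
  have h : LocallyLipschitzOn S f := fun x hx => by
    obtain ⟨C, t, ht, hC⟩ := (hf x hx).exists_lipschitzOnWith
    exact ⟨C, t, mem_nhdsWithin_of_mem_nhds ht, hC⟩
  exact h.exists_lipschitzOnWith_of_compact hS

theorem lipschitzWith_clamp : LipschitzWith 1 (fun t : ℝ => max 0 (min t 1)) :=
  (LipschitzWith.id.min_const 1).const_max 0

/-- The signed distance of `t` from the interval `[0, 1]`. -/
def excess (t : ℝ) : ℝ := t - max 0 (min t 1)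

theorem excess_eq_zero_iff {t : ℝ} : excess t = 0 ↔ t ∈ Icc (0 : ℝ) 1 := by
  unfold excess
  constructor
  · intro h
    rw [sub_eq_zero] at h
    rw [h]
    exact ⟨le_max_left _ _, max_le zero_le_one (min_le_right _ _)⟩
  · rintro ⟨h0, h1⟩
    rw [min_eq_left h1, max_eq_right h0, sub_self]

theorem abs_excess_sub_le (a b : ℝ) : |excess a - excess b| ≤ |a - b| := by
  unfold excess
  rcases max_cases 0 (min a 1) with h1 | h1 <;> rcases max_cases 0 (min b 1) with h2 | h2 <;>
  rcases min_cases a 1 with h3 | h3 <;> rcases min_cases b 1 with h4 | h4 <;>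
  rw [abs_le] <;> constructor <;> cases abs_cases (a - b) <;> linarith

theorem excess_monotone : Monotone excess := by
  intro a b hab
  unfold excess
  rcases max_cases 0 (min a 1) with h1 | h1 <;> rcases max_cases 0 (min b 1) with h2 | h2 <;>
  rcases min_cases a 1 with h3 | h3 <;> rcases min_cases b 1 with h4 | h4 <;> linarith

theorem continuous_excess : Continuous excess := by unfold excess; fun_prop

theorem signedPow_mul_excess_nonneg (p a b : ℝ) :
    0 ≤ signedPow p (a - b) * (excess a - excess b) := by
  rw [signedPow, mul_assoc]
  refine mul_nonneg (by positivity) ?_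
  rcases le_total a b with h | h
  · exact mul_nonneg_of_nonpos_of_nonpos (sub_nonpos.2 h) (sub_nonpos.2 (excess_monotone h))
  · exact mul_nonneg (sub_nonneg.2 h) (sub_nonneg.2 (excess_monotone h))

theorem excess_eq_of_signedPow_mul_eq_zero {p : ℝ} (hp : 1 < p) {a b : ℝ}
    (h : signedPow p (a - b) * (excess a - excess b) = 0) : excess a = excess b := by
  rcases mul_eq_zero.1 h with h | h
  · have h1 := abs_signedPow hp (a - b)
    rw [h, abs_zero, eq_comm, Real.rpow_eq_zero (abs_nonneg _) (by linarith), abs_eq_zero,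
      sub_eq_zero] at h1
    rw [h1]
  · exact sub_eq_zero.1 h

/-- Where `w = ψ` the value lies in `[0, 1]` and the excess vanishes, so its support stays within
that of `w - ψ`. -/
theorem IsLipTest.excess_comp {U V : Set (Rn n)} {w ψ : Rn n → ℝ} (hw : IsLipTest V w)
    (hψ : ∀ x, ψ x ∈ Icc (0 : ℝ) 1) (h : tsupport (fun x => w x - ψ x) ⊆ U) :
    IsLipTest U (fun x => excess (w x)) := by
  obtain ⟨C, hC⟩ := hw.lipschitz
  refine ⟨⟨C, LipschitzWith.of_dist_le_mul fun x y => ?_⟩,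
    hw.compact.comp_left (excess_eq_zero_iff.2 ⟨le_rfl, zero_le_one⟩), ?_⟩
  · exact (abs_excess_sub_le _ _).trans (hC.dist_le_mul x y)
  · refine Subset.trans (closure_mono fun x hx => ?_) h
    intro h0
    refine hx (excess_eq_zero_iff.2 ?_)
    have : w x = ψ x := sub_eq_zero.1 h0
    rw [this]
    exact hψ x

theorem ae_kernelMeasure_iff (hn : 0 < n) {s p Λ : ℝ} (hΛ : 1 ≤ Λ)
    {k : Rn n → Rn n → ℝ≥0∞} (hk : IsEllipticKernel s p Λ k) {P : Rn n × Rn n → Prop} :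
    (∀ᵐ z ∂(kernelMeasure k), P z) ↔ ∀ᵐ z ∂(volume.prod volume), P z := by
  refine ⟨fun h => ?_, fun h => (kernelMeasure_absolutelyContinuous k).ae_le h⟩
  rw [kernelMeasure, ae_withDensity_iff (measurable_kernel hk)] at h
  filter_upwards [h, ae_fst_ne_snd hn] with z hz hne
  refine hz (ne_of_gt (lt_of_lt_of_le ?_ (hk.lower _ _ hne)))
  have : 0 < ‖z.1 - z.2‖ := norm_pos_iff.2 (sub_ne_zero.2 hne)
  rw [ENNReal.ofReal_pos]
  positivity

theorem ae_tendsto_diff {w : ℕ → Rn n → ℝ} {u : Rn n → ℝ} (k : Rn n → Rn n → ℝ≥0∞)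
    (h : ∀ᵐ x, Tendsto (fun j => w j x) atTop (𝓝 (u x))) :
    ∀ᵐ z ∂(kernelMeasure k), Tendsto (fun j => diff (w j) z) atTop (𝓝 (diff u z)) := by
  refine (kernelMeasure_absolutelyContinuous k).ae_le ?_
  filter_upwards [Measure.quasiMeasurePreserving_fst.ae h,
    Measure.quasiMeasurePreserving_snd.ae h] with z h1 h2
  exact h1.sub h2

theorem aestronglyMeasurable_diff_of_continuous {w : Rn n → ℝ} (k : Rn n → Rn n → ℝ≥0∞)
    (hw : Continuous w) : AEStronglyMeasurable (diff w) (kernelMeasure k) :=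
  (aestronglyMeasurable_diff hw.aestronglyMeasurable).mono_ac (kernelMeasure_absolutelyContinuous k)

theorem volume_compl_ne_zero (hn : 0 < n) {Ω : Set (Rn n)} (hΩ : Bornology.IsBounded Ω) :
    volume Ωᶜ ≠ 0 := by
  have := nontrivial_Rn hn
  have : NoncompactSpace (Rn n) := NormedSpace.noncompactSpace ℝ (Rn n)
  intro h
  have h1 := measure_univ_of_isAddLeftInvariant (volume : Measure (Rn n))
  have h2 := measure_union_le (μ := (volume : Measure (Rn n))) Ω Ωᶜ
  rw [union_compl_self, h1, h, add_zero] at h2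
  exact (hΩ.measure_lt_top (μ := volume)).not_ge h2

/-- Testing with the excess of `u` over `[0, 1]` gives zero, yet the integrand is nonnegative by
monotonicity. Hence the excess is a.e. constant, and the constant is zero because `u = 0` a.e. on
the complement of the bounded set `Ω`, which has positive measure. -/
theorem potential_mem_Icc (hn : 0 < n) {s p Λ : ℝ} (hs0 : 0 < s) (hs1 : s < 1)
    (hp : 1 < p) (hΛ : 1 ≤ Λ) {k : Rn n → Rn n → ℝ≥0∞} (hk : IsEllipticKernel s p Λ k)
    {K Ω : Set (Rn n)} (hΩo : IsOpen Ω) (hΩb : Bornology.IsBounded Ω)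
    {u : Rn n → ℝ} (hu : IsPotential s p k K Ω u) {μ : Measure (Rn n)}
    (hμ : IsDistribution p k Ω u μ) (hμ0 : μ (Ω \ K) = 0) :
    ∀ᵐ x, u x ∈ Icc (0 : ℝ) 1 := by
  obtain ⟨hum, hup, ψ, w, hψ, hw, hwψ, hae, hlim⟩ :=
    exists_approx_of_isPotential hn hs0 hs1 hp hk hu
  have hT : ∀ j, IsLipTest (Ω \ K) (fun x => excess (w j x)) := fun j =>
    (hw j).isLipTest.excess_comp hψ (hwψ j)
  have hwp : ∀ j, MemLp (diff (w j)) (ENNReal.ofReal p) (kernelMeasure k) := fun j =>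
    memLp_diff_of_bound hn hs0 hs1 hp hk (hw j).isLipTest
  have haeT : ∀ᵐ x, Tendsto (fun j => excess (w j x)) atTop (𝓝 (excess (u x))) := by
    filter_upwards [hae] with x hx using (continuous_excess.tendsto _).comp hx
  -- The excess is 1-Lipschitz, so its differences are dominated by those of `w j`, with `C = 1` and
  -- `H = 0`.
  obtain ⟨hTp, hconv⟩ := tendsto_integral_signedPow_mul hp zero_le_one hup (H := 0) MemLp.zero
    hwp (ae_tendsto_diff k hae) hlim
    (fun j => aestronglyMeasurable_diff_of_continuous k (hT j).continuous)
    (ae_tendsto_diff k haeT)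
    (fun j z => by simpa [diff] using abs_excess_sub_le (w j z.1) (w j z.2))
  -- The pairing is a `μ`-integral of a function supported in `Ω \ K`, which is `μ`-null.
  have hzero : ∀ j, ∫ z, signedPow p (diff u z) * diff (fun x => excess (w j x)) z
      ∂(kernelMeasure k) = 0 := by
    intro j
    rw [← form_eq_integral hn hk, ← integral_eq_form_of_isLipTest hn hs0 hs1 hp hk hΩo hμ hup
      ((hT j).mono sdiff_subset)]
    refine integral_eq_zero_of_ae ?_
    have h1 : ∀ᵐ x ∂(μ.restrict Ω), x ∉ Ω \ K :=
      measure_mono_null (fun x hx => by simpa using hx)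
        (nonpos_iff_eq_zero.1 ((Measure.restrict_apply_le Ω (Ω \ K)).trans hμ0.le))
    filter_upwards [h1] with x hx
    exact image_eq_zero_of_notMem_tsupport (f := fun x => excess (w j x))
      fun h => hx ((hT j).support_subset h)
  simp only [hzero] at hconv
  have hI := tendsto_nhds_unique hconv tendsto_const_nhds
  have hnn : ∀ z, 0 ≤ signedPow p (diff u z) * diff (fun x => excess (u x)) z := fun z =>
    signedPow_mul_excess_nonneg p (u z.1) (u z.2)
  replace hI := (integral_eq_zero_iff_of_nonneg hnn (integrable_signedPow_mul hp hup hTp)).1 hI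
  have h2 : ∀ᵐ z : Rn n × Rn n ∂(volume.prod volume), excess (u z.1) = excess (u z.2) := by
    rw [← ae_kernelMeasure_iff hn hΛ hk]
    filter_upwards [hI] with z hz
    exact excess_eq_of_signedPow_mul_eq_zero hp hz
  have hout : ∀ᵐ x, x ∉ Ω → u x = 0 := by
    filter_upwards [hae] with x hx hxΩ
    have h0 : ∀ j, w j x = 0 := fun j =>
      image_eq_zero_of_notMem_tsupport fun h => hxΩ ((hw j).support_subset h)
    simp only [h0] at hx
    exact tendsto_nhds_unique hx tendsto_const_nhds |>.symm ▸ rfl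
  have hfreq : ∃ᶠ y in ae (volume : Measure (Rn n)), y ∉ Ω := by
    rw [frequently_ae_iff]
    exact volume_compl_ne_zero hn hΩb
  filter_upwards [Measure.ae_ae_of_ae_prod h2] with x hx
  obtain ⟨y, hy, hxy, hy0⟩ := (hfreq.and_eventually (hx.and hout)).exists
  rw [hy0 hy, excess_eq_zero_iff.2 ⟨le_rfl, zero_le_one⟩] at hxy
  exact excess_eq_zero_iff.1 hxy

/-! ### The Picone test function and the energy bound -/

theorem IsLipTest.abs_rpow {p : ℝ} (hp : 1 < p) {U : Set (Rn n)} {v : Rn n → ℝ}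
    (hv : IsLipTest U v) : IsLipTest U (fun x => |v x| ^ p) := by
  obtain ⟨C, hC⟩ := hv.lipschitz
  obtain ⟨M, hM⟩ := hv.compact.exists_bound_of_continuous hv.continuous
  obtain ⟨D, hD⟩ := exists_lipschitzOnWith_of_contDiffAt (f := fun t : ℝ => t ^ p)
    (isCompact_Icc (a := 0) (b := M)) (fun x _ =>
      (Real.contDiff_rpow_const_of_le (n := 1) (by simpa using hp.le)).contDiffAt)
  have h0 : |(0 : ℝ)| ^ p = 0 := by rw [abs_zero, Real.zero_rpow (by linarith)]
  refine ⟨⟨D * C, LipschitzWith.of_dist_le_mul fun x y => ?_⟩,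
    hv.compact.comp_left (g := fun t : ℝ => |t| ^ p) h0, ?_⟩
  · refine (hD.dist_le_mul |v x| ⟨abs_nonneg _, hM x⟩ |v y| ⟨abs_nonneg _, hM y⟩).trans ?_
    rw [NNReal.coe_mul, mul_assoc]
    refine mul_le_mul_of_nonneg_left ?_ D.2
    exact (abs_abs_sub_abs_le _ _).trans (hC.dist_le_mul x y)
  · refine (closure_mono fun x hx => ?_).trans hv.support_subset
    intro h
    exact hx (by simp only [h, h0])

theorem IsLipTest.mul_comp {U V : Set (Rn n)} {A w : Rn n → ℝ} (hA : IsLipTest U A)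
    (hw : IsLipTest V w) {B : ℝ → ℝ} {C : ℝ≥0} (hB : LipschitzWith C B) {M : ℝ}
    (hM : ∀ t, |B t| ≤ M) : IsLipTest U (fun x => A x * B (w x)) := by
  obtain ⟨D, hD⟩ := hA.lipschitz
  obtain ⟨L, hL⟩ := hw.lipschitz
  obtain ⟨N, hN⟩ := hA.compact.exists_bound_of_continuous hA.continuous
  have hM0 : 0 ≤ M := (abs_nonneg _).trans (hM 0)
  have hN0 : 0 ≤ N := (abs_nonneg _).trans (hN 0)
  refine ⟨⟨(N * (C * L) + M * D).toNNReal, LipschitzWith.of_dist_le_mul fun x y => ?_⟩,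
    hA.compact.mul_right, (tsupport_mul_subset_left).trans hA.support_subset⟩
  rw [Real.coe_toNNReal _ (by positivity), Real.dist_eq]
  have e : A x * B (w x) - A y * B (w y) = A x * (B (w x) - B (w y)) + B (w y) * (A x - A y) := by
    ring
  have h1 : |B (w x) - B (w y)| ≤ C * (L * dist x y) :=
    (hB.dist_le_mul _ _).trans (mul_le_mul_of_nonneg_left (hL.dist_le_mul x y) C.2)
  have h2 : |A x - A y| ≤ D * dist x y := hD.dist_le_mul x y
  rw [e]
  refine (abs_add_le _ _).trans ?_
  rw [abs_mul, abs_mul]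
  have h3 : |A x| * |B (w x) - B (w y)| ≤ N * (C * (L * dist x y)) :=
    mul_le_mul (hN x) h1 (abs_nonneg _) hN0
  have h4 : |B (w y)| * |A x - A y| ≤ M * (D * dist x y) :=
    mul_le_mul (hM _) h2 (abs_nonneg _) hM0
  linarith

/-- The function `t ↦ (t + ε)^{1-p}`, with `t` truncated to `[0, 1]`. -/
def clampedPow (p ε t : ℝ) : ℝ := (max 0 (min t 1) + ε) ^ (1 - p)

theorem exists_lipschitzWith_clampedPow (p : ℝ) {ε : ℝ} (hε : 0 < ε) :
    ∃ C, LipschitzWith C (clampedPow p ε) := by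
  obtain ⟨D, hD⟩ := exists_lipschitzOnWith_of_contDiffAt (f := fun t : ℝ => t ^ (1 - p))
    (isCompact_Icc (a := ε) (b := 1 + ε)) (fun x hx =>
      Real.contDiffAt_rpow_const_of_ne (hε.trans_le hx.1).ne')
  have hm : ∀ t : ℝ, max 0 (min t 1) + ε ∈ Icc ε (1 + ε) := fun t =>
    ⟨by linarith [le_max_left 0 (min t 1)], by
      linarith [max_le (zero_le_one' ℝ) (min_le_right t 1)]⟩
  refine ⟨D, LipschitzWith.of_dist_le_mul fun x y => ?_⟩
  refine (hD.dist_le_mul _ (hm x) _ (hm y)).trans (mul_le_mul_of_nonneg_left ?_ D.2)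
  rw [dist_add_right]
  simpa using lipschitzWith_clamp.dist_le_mul x y

theorem clampedPow_nonneg (p : ℝ) {ε : ℝ} (hε : 0 < ε) (t : ℝ) : 0 ≤ clampedPow p ε t := by
  unfold clampedPow
  have := le_max_left 0 (min t 1)
  positivity

theorem abs_clampedPow_le {p : ℝ} (hp : 1 < p) {ε : ℝ} (hε : 0 < ε) (t : ℝ) :
    |clampedPow p ε t| ≤ ε ^ (1 - p) := by
  rw [abs_of_nonneg (clampedPow_nonneg p hε t)]
  exact Real.rpow_le_rpow_of_nonpos hε (by linarith [le_max_left 0 (min t 1)]) (by linarith)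

theorem le_clampedPow {p : ℝ} (hp : 1 < p) {ε : ℝ} (hε : 0 < ε) (t : ℝ) :
    (1 + ε) ^ (1 - p) ≤ clampedPow p ε t := by
  refine Real.rpow_le_rpow_of_nonpos ?_ ?_ (by linarith)
  · linarith [le_max_left 0 (min t 1)]
  · linarith [max_le (zero_le_one' ℝ) (min_le_right t 1)]

theorem clampedPow_of_mem {p ε t : ℝ} (ht : t ∈ Icc (0 : ℝ) 1) :
    clampedPow p ε t = (t + ε) ^ (1 - p) := by
  rw [clampedPow, min_eq_left ht.2, max_eq_right ht.1]

/-- The test functions are `|v|^p (w_j + ε)^{1-p}` with `w_j` clamped to `[0, 1]`. The lower bound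
survives the limit in `j`, and Picone is applied to the limit, where `u` itself needs no clamping.
-/
theorem rpow_mul_measureReal_le (hn : 0 < n) {s p Λ : ℝ} (hs0 : 0 < s) (hs1 : s < 1)
    (hp : 1 < p) (hΛ : 1 ≤ Λ) {k : Rn n → Rn n → ℝ≥0∞} (hk : IsEllipticKernel s p Λ k)
    {K Ω : Set (Rn n)} (hΩo : IsOpen Ω) (hΩb : Bornology.IsBounded Ω)
    {u : Rn n → ℝ} (hu : IsPotential s p k K Ω u) {μ : Measure (Rn n)}
    (hμ : IsDistribution p k Ω u μ) (hμ0 : μ (Ω \ K) = 0) {F : Set (Rn n)} (hF : IsCompact F)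
    (hFΩ : F ⊆ Ω) {v : Rn n → ℝ} (hv : IsTest Ω v) (hvF : ∀ x ∈ F, 1 ≤ v x) {ε : ℝ}
    (hε : 0 < ε) :
    (1 + ε) ^ (1 - p) * μ.real F ≤ ∫ z, |diff v z| ^ p ∂(kernelMeasure k) := by
  have hu01 := potential_mem_Icc hn hs0 hs1 hp hΛ hk hΩo hΩb hu hμ hμ0
  obtain ⟨hum, hup, ψ, w, hψ, hw, hwψ, hae, hlim⟩ :=
    exists_approx_of_isPotential hn hs0 hs1 hp hk hu
  have hwp : ∀ j, MemLp (diff (w j)) (ENNReal.ofReal p) (kernelMeasure k) := fun j =>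
    memLp_diff_of_bound hn hs0 hs1 hp hk (hw j).isLipTest
  have hA := hv.isLipTest.abs_rpow hp
  obtain ⟨C, hC⟩ := exists_lipschitzWith_clampedPow p hε
  obtain ⟨N, hN⟩ := hA.compact.exists_bound_of_continuous hA.continuous
  have hN0 : 0 ≤ N := (norm_nonneg _).trans (hN 0)
  have hg : ∀ j, IsLipTest Ω (fun x => |v x| ^ p * clampedPow p ε (w j x)) := fun j =>
    hA.mul_comp (hw j).isLipTest hC (abs_clampedPow_le hp hε)
  have haeg : ∀ᵐ x, Tendsto (fun j => |v x| ^ p * clampedPow p ε (w j x)) atTop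
      (𝓝 (|v x| ^ p * clampedPow p ε (u x))) := by
    filter_upwards [hae] with x hx
    exact ((hC.continuous.tendsto _).comp hx).const_mul _
  -- The product rule gives the majorant: `N` bounds `|v|^p`, `C` is the Lipschitz constant of
  -- `clampedPow p ε`, and `ε ^ (1 - p)` is its supremum bound.
  obtain ⟨hgp, hconv⟩ := tendsto_integral_signedPow_mul hp
    (C := N * C) (by positivity) hup
    (((memLp_diff_of_bound hn hs0 hs1 hp hk hA).abs).const_mul (ε ^ (1 - p)))
    hwp (ae_tendsto_diff k hae) hlim
    (fun j => aestronglyMeasurable_diff_of_continuous k (hg j).continuous)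
    (ae_tendsto_diff k haeg) (fun j z => by
      set A : Rn n → ℝ := fun x => |v x| ^ p
      have e : diff (fun x => A x * clampedPow p ε (w j x)) z =
          A z.1 * (clampedPow p ε (w j z.1) - clampedPow p ε (w j z.2)) +
            clampedPow p ε (w j z.2) * diff A z := by
        simp only [diff]; ring
      have h1 : |clampedPow p ε (w j z.1) - clampedPow p ε (w j z.2)| ≤ C * |diff (w j) z| :=
        hC.dist_le_mul _ _
      change |diff (fun x => A x * clampedPow p ε (w j x)) z| ≤ _
      rw [e]
      refine (abs_add_le _ _).trans ?_
      rw [abs_mul, abs_mul]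
      have h3 := mul_le_mul (hN z.1) h1 (abs_nonneg _) hN0
      have h4 := mul_le_mul_of_nonneg_right (abs_clampedPow_le hp hε (w j z.2))
        (abs_nonneg (diff A z))
      rw [Real.norm_eq_abs] at h3
      have h5 : N * (C * |diff (w j) z|) = N * C * |diff (w j) z| := by ring
      rw [h5] at h3
      exact (add_le_add h3 h4).trans_eq (add_comm _ _))
  -- Clamping makes this bound pointwise everywhere, so nothing is needed about `u` on `μ`-charged
  -- Lebesgue-null sets.
  have hlower : ∀ j, (1 + ε) ^ (1 - p) * μ.real F ≤
      ∫ z, signedPow p (diff u z) * diff (fun x => |v x| ^ p * clampedPow p ε (w j x)) z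
        ∂(kernelMeasure k) := by
    intro j
    rw [← form_eq_integral hn hk,
      ← integral_eq_form_of_isLipTest hn hs0 hs1 hp hk hΩo hμ hup (hg j)]
    have hFi : Integrable (F.indicator fun _ => (1 + ε) ^ (1 - p)) (μ.restrict Ω) := by
      rw [integrable_indicator_iff hF.measurableSet]
      exact integrableOn_const (hs := ((Measure.restrict_apply_le _ _).trans_lt
        (hμ.finite_on_compacts _ hF hFΩ)).ne)
    have hFe : ∫ x in Ω, F.indicator (fun _ => (1 + ε) ^ (1 - p)) x ∂μ =
        (1 + ε) ^ (1 - p) * μ.real F := by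
      rw [integral_indicator hF.measurableSet, setIntegral_const, smul_eq_mul, mul_comm,
        measureReal_restrict_apply hF.measurableSet, inter_eq_left.2 hFΩ]
    rw [← hFe]
    refine integral_mono hFi ((hg j).integrable_restrict hμ) fun x => ?_
    have hcp := clampedPow_nonneg p hε (w j x)
    by_cases hx : x ∈ F
    · simp only [indicator_of_mem hx]
      have h1 : 1 ≤ |v x| ^ p :=
        Real.one_le_rpow ((hvF x hx).trans (le_abs_self _)) (by linarith)
      have h2 := le_clampedPow hp hε (w j x)
      nlinarith
    · simp only [indicator_of_notMem hx]
      positivity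
  refine (ge_of_tendsto' hconv hlower).trans ?_
  refine integral_mono_ae (integrable_signedPow_mul hp hup hgp) ?_ ?_
  · have := (memLp_diff_of_bound hn hs0 hs1 hp hk hv.isLipTest).integrable_norm_rpow
      (by simp; linarith) (by simp)
    simpa only [ENNReal.toReal_ofReal (by linarith : (0 : ℝ) ≤ p), Real.norm_eq_abs] using this
  · refine (kernelMeasure_absolutelyContinuous k).ae_le ?_
    filter_upwards [Measure.quasiMeasurePreserving_fst.ae hu01,
      Measure.quasiMeasurePreserving_snd.ae hu01] with z h1 h2
    have hpic := picone hp (a := u z.1 + ε) (b := u z.2 + ε) (c := |v z.1|) (d := |v z.2|)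
      (by linarith [h1.1]) (by linarith [h2.1]) (abs_nonneg _) (abs_nonneg _)
    simp only [diff, clampedPow_of_mem h1, clampedPow_of_mem h2]
    -- The shift by `ε` makes both Picone arguments positive and cancels in the difference.
    rw [add_sub_add_right_eq_sub] at hpic
    refine hpic.trans ?_
    exact Real.rpow_le_rpow (abs_nonneg _) (abs_abs_sub_abs_le _ _) (by linarith)

end Nonlocal

end

/-! ### The capacity estimate -/

theorem lemma5p1 {n : ℕ} (hn : 0 < n) {s p Λ : ℝ} (hs0 : 0 < s) (hs1 : s < 1) (hp : 1 < p)
    (hΛ : 1 ≤ Λ)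
    (k : Nonlocal.Rn n → Nonlocal.Rn n → ℝ≥0∞) (hk : Nonlocal.IsEllipticKernel s p Λ k)
    (Ω : Set (Nonlocal.Rn n)) (hΩo : IsOpen Ω) (hΩb : Bornology.IsBounded Ω)
    (K : Set (Nonlocal.Rn n)) (hK : IsCompact K) (hKΩ : K ⊆ Ω)
    (u : Nonlocal.Rn n → ℝ) (hu : Nonlocal.IsPotential s p k K Ω u)
    (μ : Measure (Nonlocal.Rn n)) (hμ : Nonlocal.IsDistribution p k Ω u μ)
    (E : Set (Nonlocal.Rn n)) (hE : IsCompact E) (hEΩ : E ⊆ Ω) :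
    μ E ≤ ENNReal.ofReal Λ * Nonlocal.capacity s p (K ∩ E) Ω := by
  have hμ0 : μ (Ω \ K) = 0 :=
    hμ.measure_eq_zero (hΩo.sdiff hK.isClosed) sdiff_subset hu.1.1
  have hKE : IsCompact (K ∩ E) := hK.inter hE
  have hKEΩ : K ∩ E ⊆ Ω := inter_subset_left.trans hKΩ
  have hμE : μ E ≤ μ (K ∩ E) := by
    have h1 : E ⊆ (K ∩ E) ∪ (Ω \ K) := fun x hx => by
      by_cases hxK : x ∈ K
      · exact Or.inl ⟨hxK, hx⟩
      · exact Or.inr ⟨hEΩ hx, hxK⟩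
    refine (measure_mono h1).trans ((measure_union_le _ _).trans ?_)
    rw [hμ0, add_zero]
  refine hμE.trans ?_
  have hΛ0 : ENNReal.ofReal Λ ≠ 0 := by simp; linarith
  -- Dividing by `Λ` isolates the infimum, so that one competitor `v` can be treated at a time.
  rw [mul_comm, ← ENNReal.div_le_iff hΛ0 ENNReal.ofReal_ne_top]
  refine le_iInf₂ fun v hv => ?_
  obtain ⟨hv, hv1⟩ := hv
  rw [ENNReal.div_le_iff hΛ0 ENNReal.ofReal_ne_top, mul_comm]
  refine le_trans ?_
    (Nonlocal.lintegral_diff_le hn hk (p := p) hv.smooth.continuous.aestronglyMeasurable)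
  have hreal : μ.real (K ∩ E) ≤ ∫ z, |Nonlocal.diff v z| ^ p ∂(Nonlocal.kernelMeasure k) := by
    -- The factor lost to `u ≤ 1` tends to `1` as `ε → 0`.
    have hcont : Tendsto (fun ε : ℝ => (1 + ε) ^ (1 - p) * μ.real (K ∩ E)) (𝓝[>] 0)
        (𝓝 ((1 + 0) ^ (1 - p) * μ.real (K ∩ E))) := by
      refine Tendsto.mul_const _ ?_
      have h1 : ContinuousAt (fun ε : ℝ => (1 + ε) ^ (1 - p)) 0 :=
        ContinuousAt.rpow_const (by fun_prop) (Or.inl (by norm_num))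
      exact h1.tendsto.mono_left nhdsWithin_le_nhds
    rw [add_zero, Real.one_rpow, one_mul] at hcont
    refine le_of_tendsto hcont ?_
    filter_upwards [self_mem_nhdsWithin] with ε hε
    exact Nonlocal.rpow_mul_measureReal_le hn hs0 hs1 hp hΛ hk hΩo hΩb hu hμ hμ0 hKE hKEΩ hv hv1 hε
  have hfin := (hμ.finite_on_compacts _ hKE hKEΩ).ne
  rw [← ofReal_measureReal hfin]
  refine (ENNReal.ofReal_le_ofReal hreal).trans ?_
  rw [integral_eq_lintegral_of_nonneg_ae (Eventually.of_forall fun z => by positivity)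
    ((continuous_abs.comp_aestronglyMeasurable (Nonlocal.aestronglyMeasurable_diff_of_continuous k
      hv.smooth.continuous)).aemeasurable.pow_const p).aestronglyMeasurable]
  refine ENNReal.ofReal_toReal_le.trans (lintegral_mono fun z => le_of_eq ?_)
  rw [Real.enorm_eq_ofReal_abs, ENNReal.ofReal_rpow_of_nonneg (abs_nonneg _) (by linarith)]
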